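/- Let $\mathbf A=\mathbb Z[u,u^{-1}]$ and let $S=\{s_1,s_2\}$, $s_1=(1\,2)$, $s_2=(2\,3)$, be the simple reflections of $\mathcal S_3$, with length function $\ell$. Let $\mathcal H_3$ be the Hecke algebra of $(\mathcal S_3,S)$ over $\mathbf A$: it is generated by the $T_w$, $w\in\mathcal S_3$, with $T_1=1$, $T_vT_w=T_{vw}$ if $\ell(vw)=\ell(v)+\ell(w)$, and $(T_s-u)(T_s+u^{-1})=0$ for $s\in S$. For $s\in S$ put $C'_s=T_s+u^{-1}$ and $C_s=T_s-u$. For $k\ge 1$ and $s\in S$ define $$\mathcal P^{(k)}_s=\sum_{a} c_{a_1}\otimes\cdots\otimes c_{a_k}\in\mathcal H_3^{\otimes k},\qquad c_+=C'_s,\quad c_-=-C_s,$$ where the tensor power is over $\mathbf A$ and $a=(a_1,\dots,a_k)$ runs over the sign vectors in $\{+,-\}^k$ with an even number of minus signs. Let $\bar{\mathcal H}^{(k)}_3$ be the (unital) $\mathbf A$-subalgebra of $\mathcal H_3^{\otimes k}$ generated by $\mathcal P^{(k)}_{s_1}$ and $\mathcal P^{(k)}_{s_2}$. Then, for every integer $k\ge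 1$ and with $K=\mathbb Q(u)$ the fraction field of $\mathbf A$, the $K$-algebra $K\bar{\mathcal H}^{(k)}_3=K\otimes_{\mathbf A}\bar{\mathcal H}^{(k)}_3$ is split semisimple, that is, it is semisimple and each of its irreducible modules is absolutely irreducible (remains irreducible over every field extension of $K$). Moreover, $\bar{\mathcal H}^{(k)}_3$ is a free $\mathbf A$-module of rank $4k+2$. -/

import Mathlib

open scoped TensorProduct LaurentPolynomial

universe u v w x

noncomputable section

namespace NSHecke

/-! ### The ground ring and the Hecke algebra -/

/-- The ground ring `ℤ[u, u⁻¹]`. -/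
abbrev A : Type := ℤ[T;T⁻¹]

/-- The indeterminate `u`. -/
def q : A := LaurentPolynomial.T 1

/-- Its inverse `u⁻¹`. -/
def qInv : A := LaurentPolynomial.T (-1)

/-- The length of `g` with respect to a generating set `S`: the least number of factors in an
expression of `g` as a product of elements of `S`. -/
def length {W : Type u} [Group W] (S : Set W) (g : W) : ℕ :=
  sInf {n | ∃ l : List W, l.length = n ∧ (∀ s ∈ l, s ∈ S) ∧ l.prod = g}

/-- The defining relations between the symbols `T_g`, `g ∈ W`, of the Hecke algebra of `(W, S)`. -/
inductive HeckeRel {W : Type u} [Group W] (S : Set W) :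
    FreeAlgebra A W → FreeAlgebra A W → Prop
  | one : HeckeRel S (FreeAlgebra.ι A 1) 1
  | mul (g h : W) (hgh : length S (g * h) = length S g + length S h) :
      HeckeRel S (FreeAlgebra.ι A g * FreeAlgebra.ι A h) (FreeAlgebra.ι A (g * h))
  | quadratic (s : W) (hs : s ∈ S) :
      HeckeRel S ((FreeAlgebra.ι A s - algebraMap A _ q) *
        (FreeAlgebra.ι A s + algebraMap A _ qInv)) 0

/-- The Hecke algebra of the Coxeter group `(W, S)`. -/
abbrev Hecke {W : Type u} [Group W] (S : Set W) : Type u := RingQuot (HeckeRel S)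

/-- The element `T_g` of the Hecke algebra. -/
def T {W : Type u} [Group W] (S : Set W) (g : W) : Hecke S :=
  RingQuot.mkAlgHom A (HeckeRel S) (FreeAlgebra.ι A g)

/-- The unsigned Kazhdan-Lusztig element `C'_s = T_s + u⁻¹`. -/
def CPrime {W : Type u} [Group W] (S : Set W) (s : W) : Hecke S :=
  T S s + algebraMap A _ qInv

/-- The signed Kazhdan-Lusztig element `C_s = T_s - u`. -/
def C {W : Type u} [Group W] (S : Set W) (s : W) : Hecke S :=
  T S s - algebraMap A _ q

/-! ### The nonstandard Hecke algebra -/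

/-- `[2] p_+ = C'_s` for the sign `+` (`true`), and `[2] p_- = - C_s` for the sign `-` (`false`),
where `[2] = u + u⁻¹` and `p_±` are the idempotents of the parabolic subalgebra of `s`. -/
def scaledIdem {W : Type u} [Group W] (S : Set W) (s : W) : Bool → Hecke S
  | true => CPrime S s
  | false => - C S s

/-- The `k`-th tensor power over `ℤ[u, u⁻¹]` of the Hecke algebra. -/
abbrev HeckePow {W : Type u} [Group W] (S : Set W) (k : ℕ) : Type u :=
  PiTensorProduct A (fun _ : Fin k => Hecke S)

/-- The generator `P_s^(k) = [2]^k Δ_s^(k)(p_+)`, that is, `[2]^k` times the sum of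
`p_{a 1} ⊗ ... ⊗ p_{a k}` over the sign vectors `a` with an even number of minus signs; the factor
`[2]^k` is distributed over the `k` tensor factors. -/
def P {W : Type u} [Group W] (S : Set W) (k : ℕ) (s : W) : HeckePow S k :=
  ∑ a : Fin k → Bool with Even (Finset.univ.filter fun i => a i = false).card,
    PiTensorProduct.tprod A fun i => scaledIdem S s (a i)

/-- The nonstandard Hecke algebra: the subalgebra of the `k`-th tensor power of the Hecke algebra
generated by the `P_s^(k)`, `s ∈ S`. -/
abbrev Nonstandard {W : Type u} [Group W] (S : Set W) (k : ℕ) : Subalgebra A (HeckePow S k) :=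
  Algebra.adjoin A (P S k '' S)

/-- The simple reflections `(1 2), (2 3)` of the symmetric group on three letters. -/
def simpleS3 : Set (Equiv.Perm (Fin 3)) := {Equiv.swap 0 1, Equiv.swap 1 2}

/-! ### Split semisimple algebras -/

/-- A module `M` over an algebra `B` over a field `K` is absolutely irreducible if for every field
extension `L / K` the representation `L ⊗ M` of `L ⊗ B` is irreducible: it is nonzero and its only
`L`-subspaces that are stable under `B` are zero and the whole space. The extensions range over
the universe `x`. -/
def IsAbsolutelyIrreducible (K : Type u) (B : Type v) (M : Type w) [Field K] [Ring B] [Algebra K B]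
    [AddCommGroup M] [Module K M] [Module B M] [IsScalarTower K B M] : Prop :=
  ∀ (L : Type x) [Field L] [Algebra K L],
    Nontrivial (L ⊗[K] M) ∧
    ∀ N : Submodule L (L ⊗[K] M),
      (∀ b : B, ∀ z ∈ N, (Algebra.lsmul K K M b).baseChange L z ∈ N) → N = ⊥ ∨ N = ⊤

/-- A `K`-algebra is split semisimple if it is semisimple and all its irreducible modules are
absolutely irreducible. -/
def IsSplitSemisimple (K : Type u) (B : Type v) [Field K] [Ring B] [Algebra K B] : Prop :=
  IsSemisimpleRing B ∧
  ∀ (M : Type w) [AddCommGroup M] [Module K M] [Module B M] [IsScalarTower K B M],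
    IsSimpleModule B M → IsAbsolutelyIrreducible.{u, v, w, x} K B M

end NSHecke

end

/-!
Write `[2] = u + u⁻¹`, `c = [2] ^ k` and `τ_s = (C'_s + C_s) / [2]`, an involution. Expanding tensor
powers of `C'_s + C_s` and of `C'_s - C_s = [2]` gives `2 P_s = c (1 + τ_s ^ ⊗k)` (`two_smul_P`), so
that `P_s ^ 2 = c P_s` and the nonstandard Hecke algebra is, over the fraction field, a
quotient of the group algebra of the infinite dihedral group.

In the trivial and in the sign representation of the Hecke algebra the product of the two
involutions `τ_s` is `1`, and in the two-dimensional one it has the eigenvalues `l`, `l⁻¹`, where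
`l + l⁻¹ + 2 = 4 / [2] ^ 2`. The number `l` is not a root of unity (`exists_parameter`; the proof
specializes `u` to `i`, where `[2]` vanishes). Hence on the `k`-th tensor power the product of the
two involutions is diagonalizable with the `2 k + 1` eigenvalues `l ^ m`, `|m| ≤ k`. In terms of the
central element `Y = c ^ 2 - (P₁ - P₂) ^ 2` this reads `∏ (Y - y_n) (P₁ - P₂) = 0`, the product
over `1 ≤ n ≤ k`, with `y_n = c ^ 2 (l ^ n + 2 + l ^ (-n)) / 4`. By a recursion for Chebyshev
polynomials, homogenized in `[2]`, the `y_n` lie in the ground ring (`centralRoot`). The relation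
is checked in a faithful matrix representation of the tensor power in which the two involutions are
monomial matrices (`kroneckerPow_weightHom_injective`, `aeval_centralPoly_matP`).

Everything else follows from this relation.
* Over a field, split a module into eigenspaces of `Y`. On the eigenspace of `c ^ 2` the generators
  agree; on the other ones every `v` with `P₁ v = c v` spans with `P₂ v` a submodule that is
  irreducible, over every extension field, by a direct computation. So every module is a
  sum of absolutely irreducible ones (`isSplitSemisimple_of_scaledIdempotents`).
* Over the ground ring, division by the monic polynomial `∏ (Y - y_n)` yields a spanning family with
  `4 k + 2` members (`span_spanningFamily_eq_top`), while a Vandermonde argument with the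
  eigenvalues `l ^ m` yields as many independent elements (`ReflData.linearIndependent_words`). So
  the spanning family is a basis.
-/

noncomputable section

namespace NSHecke

open Polynomial

/-! ### Representations of a pair of scaled idempotents -/

section ProjectionPair

variable {L : Type*} [Field L] {V : Type*} [AddCommGroup V] [Module L V]

/-- The two-dimensional representation of the algebra generated by a pair of scaled idempotents:
`Q₁` fixes the line of `v` (up to the scale `c`), `u = Q₂ v`, and `Q₁ Q₂ v = y v`, where
neither `y = 0` nor `y = c ^ 2`. -/
def IsPlaneVector (Q₁ Q₂ : Module.End L V) (v u : V) : Prop :=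
  ∃ c y : L, c ≠ 0 ∧ y ≠ 0 ∧ y ≠ c ^ 2 ∧ Q₁ v = c • v ∧ Q₂ v = u ∧ Q₁ u = y • v ∧
    Q₂ u = c • u

/-- The pair `(v, u)` spans an irreducible representation (if `v ≠ 0`) of the pair `Q₁, Q₂`: either
a line on which both act by the same scalar, or one of the planes of `IsPlaneVector`. -/
def IsGoodVector (Q₁ Q₂ : Module.End L V) (v u : V) : Prop :=
  (u = 0 ∧ ∃ a : L, Q₁ v = a • v ∧ Q₂ v = a • v) ∨ IsPlaneVector Q₁ Q₂ v u ∨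
    IsPlaneVector Q₂ Q₁ v u

variable {Q₁ Q₂ : Module.End L V} {v u : V}

lemma IsPlaneVector.stable (h : IsPlaneVector Q₁ Q₂ v u) {w : V}
    (hw : w ∈ Submodule.span L {v, u}) :
    Q₁ w ∈ Submodule.span L {v, u} ∧ Q₂ w ∈ Submodule.span L {v, u} := by
  obtain ⟨c, y, -, -, -, h1, h2, h3, h4⟩ := h
  obtain ⟨a, b, rfl⟩ := Submodule.mem_span_pair.mp hw
  have hv : v ∈ Submodule.span L {v, u} := Submodule.subset_span (by simp)
  have hu : u ∈ Submodule.span L {v, u} := Submodule.subset_span (by simp)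
  simp only [map_add, map_smul, h1, h2, h3, h4]
  exact ⟨add_mem (Submodule.smul_mem _ _ (Submodule.smul_mem _ _ hv))
      (Submodule.smul_mem _ _ (Submodule.smul_mem _ _ hv)),
    add_mem (Submodule.smul_mem _ _ hu) (Submodule.smul_mem _ _ (Submodule.smul_mem _ _ hu))⟩

lemma IsGoodVector.stable (h : IsGoodVector Q₁ Q₂ v u) {w : V}
    (hw : w ∈ Submodule.span L {v, u}) :
    Q₁ w ∈ Submodule.span L {v, u} ∧ Q₂ w ∈ Submodule.span L {v, u} := by
  rcases h with ⟨rfl, a, h1, h2⟩ | h | h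
  · obtain ⟨s, t, rfl⟩ := Submodule.mem_span_pair.mp hw
    have hv : v ∈ Submodule.span L {v, 0} := Submodule.subset_span (by simp)
    simp only [map_smul, h1, h2, smul_zero, add_zero, and_self]
    exact Submodule.smul_mem _ _ (Submodule.smul_mem _ _ hv)
  · exact h.stable hw
  · exact (h.stable hw).symm

lemma IsPlaneVector.span_le (h : IsPlaneVector Q₁ Q₂ v u) {N : Submodule L V}
    (hN₁ : ∀ z ∈ N, Q₁ z ∈ N) (hN₂ : ∀ z ∈ N, Q₂ z ∈ N) {w : V} (hwN : w ∈ N) (hw0 : w ≠ 0)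
    (hw : w ∈ Submodule.span L {v, u}) : Submodule.span L {v, u} ≤ N := by
  obtain ⟨c, y, hc, hy, hyc, h1, h2, h3, h4⟩ := h
  obtain ⟨a, b, rfl⟩ := Submodule.mem_span_pair.mp hw
  suffices hv : v ∈ N by
    rw [Submodule.span_le]
    rintro z (rfl | rfl)
    · exact hv
    · exact h2 ▸ hN₂ _ hv
  have e1 : Q₁ (a • v + b • u) = (c * a + y * b) • v := by
    simp only [map_add, map_smul, h1, h3]; module
  have e2 : Q₂ (a • v + b • u) = (a + c * b) • u := by
    simp only [map_add, map_smul, h2, h4]; module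
  have m1 := hN₁ _ hwN
  have m2 := hN₂ _ hwN
  rw [e1] at m1
  rw [e2] at m2
  by_cases n1 : c * a + y * b = 0
  · by_cases n2 : a + c * b = 0
    · exfalso
      -- both projections of `w` vanish only if `(y - c ^ 2) b = 0`
      have hb : (y - c ^ 2) * b = 0 := by
        linear_combination n1 - c * n2
      have hb0 : b = 0 := (mul_eq_zero.mp hb).resolve_left (sub_ne_zero.mpr hyc)
      have ha0 : a = 0 := by simpa [hb0] using n2
      exact hw0 (by simp [ha0, hb0])
    · have hu := hN₁ _ ((Submodule.smul_mem_iff _ n2).mp m2)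
      rw [h3] at hu
      exact (Submodule.smul_mem_iff _ hy).mp hu
  · exact (Submodule.smul_mem_iff _ n1).mp m1

/-- Every nonzero vector of the span of a good pair generates this span. -/
lemma IsGoodVector.span_le (h : IsGoodVector Q₁ Q₂ v u) {N : Submodule L V}
    (hN₁ : ∀ z ∈ N, Q₁ z ∈ N) (hN₂ : ∀ z ∈ N, Q₂ z ∈ N) {w : V} (hwN : w ∈ N) (hw0 : w ≠ 0)
    (hw : w ∈ Submodule.span L {v, u}) : Submodule.span L {v, u} ≤ N := by
  rcases h with ⟨rfl, a, h1, h2⟩ | h | h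
  · obtain ⟨s, t, rfl⟩ := Submodule.mem_span_pair.mp hw
    rw [smul_zero, add_zero] at hwN hw0
    have hs : s ≠ 0 := fun hs => hw0 (by simp [hs])
    rw [Submodule.span_le]
    rintro z (rfl | rfl)
    · exact (Submodule.smul_mem_iff _ hs).mp hwN
    · exact N.zero_mem
  · exact h.span_le hN₁ hN₂ hwN hw0 hw
  · exact h.span_le hN₂ hN₁ hwN hw0 hw

lemma IsPlaneVector.baseChange (h : IsPlaneVector Q₁ Q₂ v u) (F : Type*) [Field F] [Algebra L F] :
    IsPlaneVector (LinearMap.baseChange F Q₁) (LinearMap.baseChange F Q₂)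
      ((1 : F) ⊗ₜ[L] v) ((1 : F) ⊗ₜ[L] u) := by
  obtain ⟨c, y, hc, hy, hyc, h1, h2, h3, h4⟩ := h
  refine ⟨algebraMap L F c, algebraMap L F y, by simpa, by simpa, ?_, ?_, ?_, ?_, ?_⟩
  · rw [← map_pow]
    exact fun h => hyc ((algebraMap L F).injective h)
  all_goals
    simp only [LinearMap.baseChange_tmul, h1, h2, h3, h4, algebraMap_smul,
      TensorProduct.tmul_smul]

/-- Good vectors stay good under extension of scalars. -/
lemma IsGoodVector.baseChange (h : IsGoodVector Q₁ Q₂ v u) (F : Type*) [Field F] [Algebra L F] :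
    IsGoodVector (LinearMap.baseChange F Q₁) (LinearMap.baseChange F Q₂)
      ((1 : F) ⊗ₜ[L] v) ((1 : F) ⊗ₜ[L] u) := by
  rcases h with ⟨rfl, a, h1, h2⟩ | h | h
  · refine Or.inl ⟨by simp, algebraMap L F a, ?_, ?_⟩ <;>
    simp only [LinearMap.baseChange_tmul, h1, h2, algebraMap_smul, TensorProduct.tmul_smul]
  · exact Or.inr (Or.inl (h.baseChange F))
  · exact Or.inr (Or.inr (h.baseChange F))

end ProjectionPair

section Central

variable {R : Type*} [CommRing R] {B : Type*} [Ring B] [Algebra R B]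

/-- The element `c ^ 2 - (P₁ - P₂) ^ 2`, which is central in the algebra generated by two elements
with `Pᵢ ^ 2 = c Pᵢ`, and satisfies `Y P₁ = P₁ P₂ P₁`. -/
def centralElt (c : R) (P₁ P₂ : B) : B := algebraMap R B (c ^ 2) - (P₁ - P₂) ^ 2

lemma centralElt_comm (c : R) (P₁ P₂ : B) : centralElt c P₂ P₁ = centralElt c P₁ P₂ := by
  rw [centralElt, centralElt, ← neg_sub P₁ P₂, neg_sq]

variable {c : R} {P₁ P₂ : B} (h₁ : P₁ * P₁ = c • P₁) (h₂ : P₂ * P₂ = c • P₂)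

include h₁ h₂

lemma centralElt_eq :
    centralElt c P₁ P₂ = (c ^ 2) • (1 : B) - c • P₁ - c • P₂ + P₁ * P₂ + P₂ * P₁ := by
  rw [centralElt, pow_two (P₁ - P₂), mul_sub, sub_mul, sub_mul, h₁, h₂,
    Algebra.algebraMap_eq_smul_one]
  abel

lemma centralElt_mul_left : centralElt c P₁ P₂ * P₁ = P₁ * P₂ * P₁ := by
  rw [centralElt_eq h₁ h₂]
  simp only [add_mul, sub_mul, smul_mul_assoc, one_mul, mul_assoc, h₁, mul_smul_comm, smul_smul]
  module

lemma mul_centralElt_left : P₁ * centralElt c P₁ P₂ = P₁ * P₂ * P₁ := by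
  rw [centralElt_eq h₁ h₂]
  simp only [mul_add, mul_sub, ← mul_assoc, mul_one, h₁, mul_smul_comm, smul_smul, smul_mul_assoc]
  module

lemma commute_centralElt_left : Commute (centralElt c P₁ P₂) P₁ :=
  (centralElt_mul_left h₁ h₂).trans (mul_centralElt_left h₁ h₂).symm

lemma commute_centralElt_right : Commute (centralElt c P₁ P₂) P₂ := by
  rw [← centralElt_comm]
  exact commute_centralElt_left h₂ h₁

lemma centralElt_mul_right : centralElt c P₁ P₂ * P₂ = P₂ * P₁ * P₂ := by
  rw [← centralElt_comm]
  exact centralElt_mul_left h₂ h₁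

end Central

/-! ### Split semisimplicity of an algebra generated by two scaled idempotents -/

section SplitSemisimple

variable {K : Type*} [Field K] {B : Type*} [Ring B] [Algebra K B]
  {M : Type*} [AddCommGroup M] [Module K M] [Module B M] [IsScalarTower K B M]

lemma smul_mem_of_adjoin_eq_top {P₁ P₂ : B} (hadj : Algebra.adjoin K {P₁, P₂} = ⊤)
    {N : Submodule K M} (hN₁ : ∀ z ∈ N, P₁ • z ∈ N) (hN₂ : ∀ z ∈ N, P₂ • z ∈ N) (b : B)
    {z : M} (hz : z ∈ N) : b • z ∈ N := by
  have hb : b ∈ Algebra.adjoin K {P₁, P₂} := hadj ▸ Algebra.mem_top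
  induction hb using Algebra.adjoin_induction generalizing z with
  | mem x hx =>
    rcases hx with rfl | rfl
    · exact hN₁ _ hz
    · exact hN₂ _ hz
  | algebraMap r => rw [algebraMap_smul]; exact N.smul_mem _ hz
  | add x y _ _ hx hy => rw [add_smul]; exact N.add_mem (hx hz) (hy hz)
  | mul x y _ _ hx hy => rw [mul_smul]; exact hx (hy hz)

/-- The action of `b` on the module `M`, as a `K`-linear endomorphism. -/
abbrev act (K : Type*) [Field K] {B : Type*} [Ring B] [Algebra K B]
    (M : Type*) [AddCommGroup M] [Module K M] [Module B M] [IsScalarTower K B M] (b : B) :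
    Module.End K M := Algebra.lsmul K K M b

/-- On a vector killed by `y - z`, a polynomial in `y` acts by its value at `z`. -/
lemma aeval_smul_of_eigenvector {y : B} {z : K} {m : M} (hm : y • m = z • m) (p : K[X]) :
    aeval y p • m = p.eval z • m := by
  induction p using Polynomial.induction_on' with
  | add p q hp hq => rw [map_add, add_smul, hp, hq, eval_add, add_smul]
  | monomial n a =>
    rw [aeval_monomial, eval_monomial, mul_smul, mul_smul, algebraMap_smul]
    congr 1
    induction n with
    | zero => simp
    | succ n ih =>
      rw [pow_succ, mul_smul, hm, smul_comm (y ^ n) z m, ih, ← mul_smul, pow_succ, mul_comm]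

/-- An element annihilated by a polynomial with distinct roots in `K` is diagonalizable on every
module. -/
lemma mem_span_eigenvectors [DecidableEq K] {y : B} {s : Finset K} (hs : s.Nonempty)
    (hy : aeval y (∏ z ∈ s, (X - Polynomial.C z)) = 0) (m : M) :
    m ∈ Submodule.span K {v : M | ∃ z ∈ s, y • v = z • v} := by
  have h1 : m = ∑ z ∈ s, aeval y (Lagrange.basis s id z) • m := by
    rw [← Finset.sum_smul, ← map_sum, Lagrange.sum_basis (Set.injOn_id _) hs, map_one, one_smul]
  rw [h1]
  refine sum_mem fun z hz => Submodule.subset_span ⟨z, hz, ?_⟩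
  have h2 : (X - Polynomial.C z) * Lagrange.basis s id z =
      (∏ j ∈ s.erase z, Polynomial.C (z - j)⁻¹) * ∏ z ∈ s, (X - Polynomial.C z) := by
    rw [Lagrange.basis, ← Finset.mul_prod_erase s _ hz]
    simp only [Lagrange.basisDivisor, Finset.prod_mul_distrib, id]
    ring
  have h3 : aeval y ((X - Polynomial.C z) * Lagrange.basis s id z) = 0 := by
    rw [h2, map_mul, hy, mul_zero]
  rw [map_mul, map_sub, aeval_X, aeval_C, sub_mul, sub_eq_zero] at h3
  rw [← mul_smul, h3, mul_smul, algebraMap_smul]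

variable {c : K} {P₁ P₂ : B} {s : Finset K}

section Eigenspaces

variable (hc : c ≠ 0) (h₁ : P₁ * P₁ = c • P₁) (h₂ : P₂ * P₂ = c • P₂)

include hc h₁ h₂

lemma isPlaneVector_smul {z : K} (hz : z ≠ 0) (hzc : z ≠ c ^ 2) {v : M}
    (hv : centralElt c P₁ P₂ • v = z • v) :
    IsPlaneVector (act K M P₁) (act K M P₂) (P₁ • v) (P₂ • P₁ • v) := by
  refine ⟨c, z, hc, hz, hzc, ?_, rfl, ?_, ?_⟩
  · change P₁ • P₁ • v = _
    rw [← mul_smul, h₁, smul_assoc]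
  · change P₁ • P₂ • P₁ • v = _
    rw [← mul_smul, ← mul_smul, ← mul_centralElt_left h₁ h₂, mul_smul, hv, smul_comm]
  · change P₂ • P₂ • P₁ • v = _
    rw [← mul_smul, h₂, smul_assoc]

/-- Every module is spanned by good vectors: split it into eigenspaces of the central element; on
the eigenspace of `c ^ 2` the elements `P₁` and `P₂` agree, and on another eigenspace the vector
`v` is, up to a nonzero scalar, `(P₁ - P₂) ^ 2 • v`. -/
lemma span_isGoodVector_eq_top (hs0 : (0 : K) ∉ s) (hsc : c ^ 2 ∉ s)
    (hrel : aeval (centralElt c P₁ P₂) (∏ z ∈ s, (X - Polynomial.C z)) * (P₁ - P₂) = 0) :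
    Submodule.span K {v : M | ∃ u, IsGoodVector (act K M P₁) (act K M P₂) v u} = ⊤ := by
  classical
  set Y := centralElt c P₁ P₂ with hY
  have hann : aeval Y (∏ z ∈ insert (c ^ 2) s, (X - Polynomial.C z)) = 0 := by
    rw [Finset.prod_insert hsc, mul_comm, map_mul, map_sub, aeval_X, aeval_C]
    have : Y - algebraMap K B (c ^ 2) = - ((P₁ - P₂) * (P₁ - P₂)) := by
      rw [hY, centralElt, pow_two (P₁ - P₂)]; abel
    rw [this, mul_neg, ← mul_assoc, hrel, zero_mul, neg_zero]
  rw [eq_top_iff]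
  intro m _
  refine (Submodule.span_le.mpr ?_) (mem_span_eigenvectors (Finset.insert_nonempty _ _) hann m)
  rintro v ⟨z, hz, hv⟩
  rw [SetLike.mem_coe]
  set G := Submodule.span K {v : M | ∃ u, IsGoodVector (act K M P₁) (act K M P₂) v u}
  have hgood : ∀ {v u : M}, IsGoodVector (act K M P₁) (act K M P₂) v u → v ∈ G :=
    fun h => Submodule.subset_span ⟨_, h⟩
  rcases Finset.mem_insert.mp hz with rfl | hz
  · have hcomm : Y * (P₁ - P₂) = (P₁ - P₂) * Y :=
      ((commute_centralElt_left h₁ h₂).sub_right (commute_centralElt_right h₁ h₂)).eq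
    have hd : Y • (P₁ - P₂) • v = c ^ 2 • (P₁ - P₂) • v := by
      rw [← mul_smul, hcomm, mul_smul, hv, smul_comm]
    have h3 := aeval_smul_of_eigenvector hd (∏ z ∈ s, (X - Polynomial.C z))
    rw [← mul_smul, hrel, zero_smul, eq_comm, smul_eq_zero, eval_prod, Finset.prod_eq_zero_iff]
      at h3
    have h4 : P₁ • v = P₂ • v := by
      rcases h3 with ⟨a, ha, ha0⟩ | h3
      · rw [eval_sub, eval_X, eval_C, sub_eq_zero] at ha0
        exact absurd (ha0 ▸ ha) hsc
      · rwa [sub_smul, sub_eq_zero] at h3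
    have g1 : P₁ • v ∈ G := by
      refine hgood (u := 0) (Or.inl ⟨rfl, c, ?_, ?_⟩)
      · change P₁ • P₁ • v = _
        rw [← mul_smul, h₁, smul_assoc]
      · change P₂ • P₁ • v = _
        rw [h4, ← mul_smul, h₂, smul_assoc]
    have g2 : c • v - P₁ • v ∈ G := by
      refine hgood (u := 0) (Or.inl ⟨rfl, 0, ?_, ?_⟩)
      · change P₁ • (c • v - P₁ • v) = _
        rw [smul_sub, ← mul_smul, h₁, smul_assoc, smul_comm, sub_self, zero_smul]
      · change P₂ • (c • v - P₁ • v) = _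
        rw [h4, smul_sub, ← mul_smul, h₂, smul_assoc, smul_comm, sub_self, zero_smul]
    have := G.add_mem g1 g2
    rwa [add_sub_cancel, Submodule.smul_mem_iff _ hc] at this
  · have hz0 : z ≠ 0 := fun h => hs0 (h ▸ hz)
    have hzc : z ≠ c ^ 2 := fun h => hsc (h ▸ hz)
    have e : (c ^ 2 - z) • v = c • P₁ • v + c • P₂ • v - P₁ • P₂ • v - P₂ • P₁ • v := by
      rw [sub_smul, ← hv, hY, centralElt_eq h₁ h₂]
      simp only [add_smul, sub_smul, mul_smul, smul_assoc, one_smul]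
      abel
    have p1 : ∀ v : M, Y • v = z • v → P₁ • v ∈ G := fun v hv =>
      hgood (Or.inr (Or.inl (isPlaneVector_smul hc h₁ h₂ hz0 hzc hv)))
    have p2 : ∀ v : M, Y • v = z • v → P₂ • v ∈ G := fun v hv =>
      hgood (Or.inr (Or.inr (isPlaneVector_smul hc h₂ h₁ hz0 hzc
        (by rwa [centralElt_comm]))))
    have e1 : Y • P₁ • v = z • P₁ • v := by
      rw [← mul_smul, (commute_centralElt_left h₁ h₂).eq, mul_smul, ← hY, hv, smul_comm]
    have e2 : Y • P₂ • v = z • P₂ • v := by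
      rw [← mul_smul, (commute_centralElt_right h₁ h₂).eq, mul_smul, ← hY, hv, smul_comm]
    have hmem : (c ^ 2 - z) • v ∈ G := by
      rw [e]
      exact sub_mem (sub_mem (add_mem (G.smul_mem _ (p1 v hv)) (G.smul_mem _ (p2 v hv)))
        (p1 _ e2)) (p2 _ e1)
    exact (Submodule.smul_mem_iff _ (sub_ne_zero.mpr hzc.symm)).mp hmem

end Eigenspaces

lemma IsGoodVector.span_singleton_le {v u : M} (hadj : Algebra.adjoin K {P₁, P₂} = ⊤)
    (h : IsGoodVector (act K M P₁) (act K M P₂) v u) {w : M}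
    (hw : w ∈ Submodule.span B {v}) : w ∈ Submodule.span K {v, u} := by
  obtain ⟨b, rfl⟩ := Submodule.mem_span_singleton.mp hw
  exact smul_mem_of_adjoin_eq_top hadj (fun z hz => (h.stable hz).1) (fun z hz => (h.stable hz).2)
    b (Submodule.subset_span (by simp))

lemma IsGoodVector.isSimpleModule_span {v u : M} (hadj : Algebra.adjoin K {P₁, P₂} = ⊤)
    (h : IsGoodVector (act K M P₁) (act K M P₂) v u) (hv : v ≠ 0) :
    IsSimpleModule B (Submodule.span B {v}) := by
  rw [isSimpleModule_iff_toSpanSingleton_surjective]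
  have hvm : v ∈ Submodule.span B {v} := Submodule.mem_span_singleton_self v
  refine ⟨⟨⟨v, hvm⟩, 0, fun h => hv (congrArg Subtype.val h)⟩, ?_⟩
  rintro ⟨w, hw⟩ hw0 ⟨t, ht⟩
  have hw0' : w ≠ 0 := fun h => hw0 (Subtype.ext h)
  have key := h.span_le (N := (Submodule.span B {w}).restrictScalars K)
    (fun z hz => Submodule.smul_mem _ P₁ hz) (fun z hz => Submodule.smul_mem _ P₂ hz)
    (Submodule.mem_span_singleton_self w) hw0' (h.span_singleton_le hadj hw)
  have hvw : v ∈ Submodule.span B {w} := key (Submodule.subset_span (by simp))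
  obtain ⟨a, ha⟩ := Submodule.mem_span_singleton.mp hvw
  obtain ⟨b, hb⟩ := Submodule.mem_span_singleton.mp ht
  refine ⟨b * a, Subtype.ext ?_⟩
  simp [mul_smul, ha, hb]

end SplitSemisimple

/-- An algebra generated by two scaled idempotents `P₁`, `P₂` is split semisimple if
`(P₁ - P₂) ∏ (Y - z) = 0` in it, where `Y` is the central element and `z` runs over distinct
scalars other than `0` and `c ^ 2`. -/
theorem isSplitSemisimple_of_scaledIdempotents {K : Type u} {B : Type v} [Field K] [Ring B]
    [Algebra K B] {c : K} {P₁ P₂ : B} {s : Finset K} (hadj : Algebra.adjoin K {P₁, P₂} = ⊤)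
    (hc : c ≠ 0) (h₁ : P₁ * P₁ = c • P₁) (h₂ : P₂ * P₂ = c • P₂)
    (hs0 : (0 : K) ∉ s) (hsc : c ^ 2 ∉ s)
    (hrel : aeval (centralElt c P₁ P₂) (∏ z ∈ s, (X - Polynomial.C z)) * (P₁ - P₂) = 0) :
    IsSplitSemisimple.{u, v, w, x} K B := by
  refine ⟨?_, ?_⟩
  · refine IsSemisimpleModule.of_sSup_simples_eq_top ?_
    have htop := span_isGoodVector_eq_top (M := B) hc h₁ h₂ hs0 hsc hrel
    rw [← Submodule.restrictScalars_eq_top_iff K B B, eq_top_iff, ← htop, Submodule.span_le]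
    rintro v ⟨u, hu⟩
    by_cases hv : v = 0
    · rw [hv]; exact Submodule.zero_mem _
    · exact (le_sSup (show Submodule.span B {v} ∈ {m : Submodule B B | IsSimpleModule B m} from
        hu.isSimpleModule_span hadj hv)) (Submodule.mem_span_singleton_self v)
  · intro M _ _ _ _ hM L _ _
    have htop := span_isGoodVector_eq_top (M := M) hc h₁ h₂ hs0 hsc hrel
    have := IsSimpleModule.nontrivial B M
    refine ⟨inferInstance, fun N hN => ?_⟩
    obtain ⟨v, ⟨u, hu⟩, hv⟩ : ∃ v ∈ {v : M | ∃ u, IsGoodVector (act K M P₁) (act K M P₂) v u},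
        v ≠ 0 := by
      by_contra! hcon
      exact bot_ne_top ((Submodule.span_eq_bot.mpr hcon).symm.trans htop)
    have hspan : Submodule.span K {v, u} = ⊤ := by
      rw [eq_top_iff]
      intro w _
      refine hu.span_singleton_le hadj ?_
      rw [IsSimpleModule.span_singleton_eq_top B hv]
      trivial
    have hspanL : Submodule.span L {(1 : L) ⊗ₜ[K] v, (1 : L) ⊗ₜ[K] u} = ⊤ := by
      have := congrArg (Submodule.baseChange L) hspan
      rwa [Submodule.baseChange_span, Submodule.baseChange_top, Set.image_pair] at this
    refine or_iff_not_imp_left.mpr fun hbot => ?_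
    obtain ⟨w, hwN, hw0⟩ := Submodule.exists_mem_ne_zero_of_ne_bot hbot
    rw [eq_top_iff, ← hspanL]
    exact (hu.baseChange L).span_le (hN P₁) (hN P₂) hwN hw0 (hspanL ▸ Submodule.mem_top)

/-! ### A spanning family over a commutative ring -/

section SpanningFamily

variable {R : Type*} [CommRing R] {B : Type*} [Ring B] [Algebra R B]

/-- The products of powers of the central element with `1`, `P₁` (exponents up to `k`) and with
`P₂`, `P₁ P₂` (exponents below `k`). -/
def spanningFamily (c : R) (P₁ P₂ : B) (k : ℕ) :
    Fin (k + 1) ⊕ Fin (k + 1) ⊕ Fin k ⊕ Fin k → B :=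
  Sum.elim (fun j => centralElt c P₁ P₂ ^ (j : ℕ) * 1) <|
    Sum.elim (fun j => centralElt c P₁ P₂ ^ (j : ℕ) * P₁) <|
      Sum.elim (fun j => centralElt c P₁ P₂ ^ (j : ℕ) * P₂)
        (fun j => centralElt c P₁ P₂ ^ (j : ℕ) * (P₁ * P₂))

lemma aeval_mul_mem_of_natDegree_lt {S : Submodule R B} {y g : B} {n : ℕ}
    (h : ∀ j : Fin n, y ^ (j : ℕ) * g ∈ S) {p : R[X]} (hp : p = 0 ∨ p.natDegree < n) :
    aeval y p * g ∈ S := by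
  rcases hp with rfl | hp
  · simp
  rw [aeval_eq_sum_range' hp, Finset.sum_mul]
  refine sum_mem fun i hi => ?_
  rw [smul_mul_assoc]
  exact S.smul_mem _ (h ⟨i, Finset.mem_range.mp hi⟩)

lemma modByMonic_eq_zero_or_natDegree_lt [Nontrivial R] (p : R[X]) {f : R[X]} (hf : f.Monic) :
    p %ₘ f = 0 ∨ (p %ₘ f).natDegree < f.natDegree := by
  by_cases h1 : f = 1
  · left; rw [h1, modByMonic_one]
  · exact Or.inr (natDegree_modByMonic_lt p hf h1)

variable [Nontrivial R] {c : R} {P₁ P₂ : B} {f : R[X]}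

section Reduction

variable (h₁ : P₁ * P₁ = c • P₁) (h₂ : P₂ * P₂ = c • P₂) (hf : f.Monic)
  (hrel : aeval (centralElt c P₁ P₂) f * (P₁ - P₂) = 0)

include h₁ h₂ hf hrel

omit h₁ in
/-- Reduction modulo `f` and modulo `f * (X - c ^ 2)`: the polynomial multiples of `1`, `P₁`, `P₂`
and `P₁ P₂` over the central element are combinations of the spanning family. -/
lemma aeval_mul_mem_span (p : R[X]) :
    aeval (centralElt c P₁ P₂) p * 1 ∈
        Submodule.span R (Set.range (spanningFamily c P₁ P₂ f.natDegree)) ∧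
      aeval (centralElt c P₁ P₂) p * P₁ ∈
        Submodule.span R (Set.range (spanningFamily c P₁ P₂ f.natDegree)) ∧
      aeval (centralElt c P₁ P₂) p * P₂ ∈
        Submodule.span R (Set.range (spanningFamily c P₁ P₂ f.natDegree)) ∧
      aeval (centralElt c P₁ P₂) p * (P₁ * P₂) ∈
        Submodule.span R (Set.range (spanningFamily c P₁ P₂ f.natDegree)) := by
  set Y := centralElt c P₁ P₂ with hY
  set S := Submodule.span R (Set.range (spanningFamily c P₁ P₂ f.natDegree))
  have hmem : ∀ i, spanningFamily c P₁ P₂ f.natDegree i ∈ S :=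
    fun i => Submodule.subset_span ⟨i, rfl⟩
  have hF : (f * (X - Polynomial.C (c ^ 2))).Monic := hf.mul (monic_X_sub_C _)
  have hFdeg : (f * (X - Polynomial.C (c ^ 2))).natDegree = f.natDegree + 1 := by
    rw [hf.natDegree_mul (monic_X_sub_C _), natDegree_X_sub_C]
  have hF0 : aeval Y (f * (X - Polynomial.C (c ^ 2))) = 0 := by
    have : Y - algebraMap R B (c ^ 2) = - ((P₁ - P₂) * (P₁ - P₂)) := by
      rw [hY, centralElt, pow_two (P₁ - P₂)]; abel
    rw [map_mul, map_sub, aeval_X, aeval_C, this, mul_neg, ← mul_assoc, hrel, zero_mul, neg_zero]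
  have hred : ∀ (p : R[X]) (g : B), (∀ j : Fin (f.natDegree + 1), Y ^ (j : ℕ) * g ∈ S) →
      aeval Y p * g ∈ S := by
    intro p g hg
    have e : aeval Y p = aeval Y (p %ₘ (f * (X - Polynomial.C (c ^ 2)))) := by
      conv_lhs => rw [← modByMonic_add_div p (f * (X - Polynomial.C (c ^ 2)))]
      rw [map_add, map_mul, hF0, zero_mul, add_zero]
    rw [e]
    refine aeval_mul_mem_of_natDegree_lt hg ?_
    rw [← hFdeg]
    exact modByMonic_eq_zero_or_natDegree_lt p hF
  have m1 : ∀ p : R[X], aeval Y p * P₁ ∈ S := fun p => hred p P₁ fun j => hmem (Sum.inr (Sum.inl j))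
  -- a multiple of `f` may be moved between `g` and `g'` when `aeval Y f * g = aeval Y f * g'`
  have hred' : ∀ (p : R[X]) (g g' : B), aeval Y f * g = aeval Y f * g' →
      (∀ p : R[X], aeval Y p * g' ∈ S) → (∀ j : Fin f.natDegree, Y ^ (j : ℕ) * g ∈ S) →
      aeval Y p * g ∈ S := by
    intro p g g' hgg hg' hg
    have e : aeval Y p * g = aeval Y (p %ₘ f) * g + aeval Y ((p /ₘ f) * f) * g' := by
      conv_lhs => rw [← modByMonic_add_div p f, mul_comm f]
      rw [map_add, map_mul, add_mul, mul_assoc _ _ g, hgg, mul_assoc _ _ g']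
    rw [e]
    exact S.add_mem (aeval_mul_mem_of_natDegree_lt hg (modByMonic_eq_zero_or_natDegree_lt p hf))
      (hg' _)
  have hrel' : aeval Y f * P₁ = aeval Y f * P₂ := by rwa [mul_sub, sub_eq_zero] at hrel
  have m2 : ∀ p : R[X], aeval Y p * P₂ ∈ S := fun p => hred' p P₂ P₁ hrel'.symm m1
    fun j => hmem (Sum.inr (Sum.inr (Sum.inl j)))
  refine ⟨hred p 1 fun j => hmem (Sum.inl j), m1 p, m2 p, ?_⟩
  refine hred' p (P₁ * P₂) (c • P₂) ?_ (fun p => ?_)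
    fun j => hmem (Sum.inr (Sum.inr (Sum.inr j)))
  · rw [← mul_assoc, hrel', mul_assoc, h₂]
  · rw [mul_smul_comm]; exact S.smul_mem _ (m2 p)

/-- The spanning family spans: its span contains `1` and is stable under left multiplication by
`P₁` and by `P₂`. -/
lemma span_spanningFamily_eq_top (hadj : Algebra.adjoin R {P₁, P₂} = ⊤) :
    Submodule.span R (Set.range (spanningFamily c P₁ P₂ f.natDegree)) = ⊤ := by
  have hmem := aeval_mul_mem_span h₂ hf hrel
  set Y := centralElt c P₁ P₂ with hY
  set S := Submodule.span R (Set.range (spanningFamily c P₁ P₂ f.natDegree))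
  have c1 : ∀ (n : ℕ) (g : B), P₁ * (Y ^ n * g) = Y ^ n * (P₁ * g) := fun n g => by
    rw [← mul_assoc, ((commute_centralElt_left h₁ h₂).pow_left n).eq.symm, mul_assoc]
  have c2 : ∀ (n : ℕ) (g : B), P₂ * (Y ^ n * g) = Y ^ n * (P₂ * g) := fun n g => by
    rw [← mul_assoc, ((commute_centralElt_right h₁ h₂).pow_left n).eq.symm, mul_assoc]
  have hp : ∀ n : ℕ, Y ^ n * 1 ∈ S ∧ Y ^ n * P₁ ∈ S ∧ Y ^ n * P₂ ∈ S ∧ Y ^ n * (P₁ * P₂) ∈ S := by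
    intro n
    simpa using hmem (X ^ n)
  have s1 : ∀ z ∈ S, P₁ * z ∈ S := by
    intro z hz
    induction hz using Submodule.span_induction with
    | zero => simp
    | add x y _ _ hx hy => rw [mul_add]; exact S.add_mem hx hy
    | smul a x _ hx => rw [mul_smul_comm]; exact S.smul_mem _ hx
    | mem x hx =>
      obtain ⟨i, rfl⟩ := hx
      rcases i with j | j | j | j <;> simp only [spanningFamily, Sum.elim_inl, Sum.elim_inr] <;>
        rw [← hY, c1]
      · rw [mul_one]; exact (hp j).2.1
      · rw [h₁, mul_smul_comm]; exact S.smul_mem _ (hp j).2.1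
      · exact (hp j).2.2.2
      · rw [← mul_assoc P₁, h₁, smul_mul_assoc, mul_smul_comm]
        exact S.smul_mem _ (hp j).2.2.2
  have s2 : ∀ z ∈ S, P₂ * z ∈ S := by
    intro z hz
    induction hz using Submodule.span_induction with
    | zero => simp
    | add x y _ _ hx hy => rw [mul_add]; exact S.add_mem hx hy
    | smul a x _ hx => rw [mul_smul_comm]; exact S.smul_mem _ hx
    | mem x hx =>
      obtain ⟨i, rfl⟩ := hx
      rcases i with j | j | j | j <;> simp only [spanningFamily, Sum.elim_inl, Sum.elim_inr] <;>
        rw [← hY, c2]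
      · rw [mul_one]; exact (hp j).2.2.1
      · have e : P₂ * P₁ = Y * 1 - c ^ 2 • (1 : B) + c • P₁ + c • P₂ - P₁ * P₂ := by
          rw [hY, centralElt_eq h₁ h₂, mul_one]; abel
        rw [e, mul_sub, mul_add, mul_add, mul_sub, ← mul_assoc, ← pow_succ, mul_smul_comm,
          mul_smul_comm, mul_smul_comm]
        exact sub_mem (add_mem (add_mem (sub_mem (hp _).1 (S.smul_mem _ (hp _).1))
          (S.smul_mem _ (hp _).2.1)) (S.smul_mem _ (hp _).2.2.1)) (hp _).2.2.2
      · rw [h₂, mul_smul_comm]; exact S.smul_mem _ (hp j).2.2.1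
      · rw [← mul_assoc P₂, ← centralElt_mul_right h₁ h₂, ← mul_assoc, ← pow_succ]
        exact (hp _).2.2.1
  rw [eq_top_iff]
  intro b _
  suffices ∀ z ∈ S, b * z ∈ S by simpa using this 1 (by simpa using (hp 0).1)
  have hb : b ∈ Algebra.adjoin R {P₁, P₂} := hadj ▸ Algebra.mem_top
  induction hb using Algebra.adjoin_induction with
  | mem x hx =>
    rcases hx with rfl | rfl
    · exact s1
    · exact s2
  | algebraMap r =>
    intro z hz
    rw [← Algebra.smul_def]; exact S.smul_mem _ hz
  | add x y _ _ hx hy =>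
    intro z hz
    rw [add_mul]
    exact S.add_mem (hx trivial z hz) (hy trivial z hz)
  | mul x y _ _ hx hy =>
    intro z hz
    rw [mul_assoc]
    exact hx trivial _ (hy trivial z hz)

end Reduction

lemma free_and_finrank_of_span_of_linearIndependent {M : Type*} [AddCommGroup M] [Module R M]
    {ι κ : Type*} [Fintype ι] [Fintype κ] {e : ι → M} (he : Submodule.span R (Set.range e) = ⊤)
    {v : κ → M} (hv : LinearIndependent R v) (hcard : Fintype.card ι = Fintype.card κ) :
    Module.Free R M ∧ Module.finrank R M = Fintype.card κ := by
  have hfin : Module.Finite R M := ⟨Submodule.fg_def.mpr ⟨_, Set.finite_range e, he⟩⟩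
  have h1 : Fintype.card κ ≤ Module.finrank R M := hv.fintype_card_le_finrank
  have h2 : Module.finrank R M ≤ Fintype.card ι := by
    rw [← finrank_top, ← he]
    exact finrank_range_le_card e
  have h3 : Fintype.card ι = Module.finrank R M := by omega
  exact ⟨Module.Free.of_basis (basisOfTopLeSpanOfCardEqFinrank e he.ge h3), by omega⟩

end SpanningFamily

/-! ### The Hecke algebra of `S₃` -/

section SymmetricGroup

/-- The two simple reflections of `S₃`, indexed by `Bool`. -/
def simpleRefl : Bool → Equiv.Perm (Fin 3)
  | false => Equiv.swap 0 1
  | true => Equiv.swap 1 2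

/-- A reduced word for each element of `S₃`; the longest element has two, and the one that starts
with `swap 0 1` is chosen. -/
def reducedWord (g : Equiv.Perm (Fin 3)) : List Bool :=
  if g = 1 then [] else
  if g = Equiv.swap 0 1 then [false] else
  if g = Equiv.swap 1 2 then [true] else
  if g = Equiv.swap 0 1 * Equiv.swap 1 2 then [false, true] else
  if g = Equiv.swap 1 2 * Equiv.swap 0 1 then [true, false] else
  [false, true, false]

lemma prod_reducedWord : ∀ g, ((reducedWord g).map simpleRefl).prod = g := by decide

lemma length_reducedWord_mul_le :
    ∀ b g, (reducedWord (simpleRefl b * g)).length ≤ (reducedWord g).length + 1 := by decide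

lemma length_reducedWord_mul : ∀ b g,
    (reducedWord (simpleRefl b * g)).length = (reducedWord g).length + 1 ∨
      (reducedWord g).length = (reducedWord (simpleRefl b * g)).length + 1 := by decide

lemma eq_one_or_exists_descent : ∀ g, g = 1 ∨
    ∃ b, (reducedWord g).length = (reducedWord (simpleRefl b * g)).length + 1 := by decide

/-- The concatenation of the words of `g` and `h` is the word of `g * h`, or the other reduced word
of the longest element. -/
lemma reducedWord_append : ∀ g h,
    (reducedWord (g * h)).length = (reducedWord g).length + (reducedWord h).length →
    reducedWord g ++ reducedWord h = reducedWord (g * h) ∨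
      (reducedWord g ++ reducedWord h = [true, false, true] ∧
        reducedWord (g * h) = [false, true, false]) := by decide

lemma reducedWord_simpleRefl : ∀ b, reducedWord (simpleRefl b) = [b] := by decide

lemma simpleRefl_mul_self_mul : ∀ b g, simpleRefl b * (simpleRefl b * g) = g := by decide

lemma mem_simpleS3_iff {s : Equiv.Perm (Fin 3)} : s ∈ simpleS3 ↔ ∃ b, simpleRefl b = s := by
  simp [simpleS3, simpleRefl, eq_comm]

lemma simpleRefl_mem (b : Bool) : simpleRefl b ∈ simpleS3 := mem_simpleS3_iff.mpr ⟨b, rfl⟩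

lemma length_simpleS3 (g : Equiv.Perm (Fin 3)) : length simpleS3 g = (reducedWord g).length := by
  refine le_antisymm (Nat.sInf_le ⟨(reducedWord g).map simpleRefl, by simp, ?_,
    prod_reducedWord g⟩) (le_csInf ⟨_, (reducedWord g).map simpleRefl, rfl, ?_,
    prod_reducedWord g⟩ ?_)
  · simp only [List.mem_map]
    rintro s ⟨b, -, rfl⟩
    exact simpleRefl_mem b
  · simp only [List.mem_map]
    rintro s ⟨b, -, rfl⟩
    exact simpleRefl_mem b
  · rintro n ⟨l, rfl, hl, rfl⟩
    induction l with
    | nil => decide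
    | cons s l ih =>
      obtain ⟨b, rfl⟩ := mem_simpleS3_iff.mp (hl s (by simp))
      rw [List.prod_cons, List.length_cons]
      exact (length_reducedWord_mul_le b _).trans
        (Nat.succ_le_succ (ih fun s hs => hl s (List.mem_cons_of_mem _ hs)))

end SymmetricGroup

section HeckeAlgebra

lemma q_mul_qInv : q * qInv = 1 := by
  rw [q, qInv, ← LaurentPolynomial.T_add]; simp

/-- Elements that satisfy the quadratic and the braid relations define a representation of the Hecke
algebra of `S₃`. -/
def heckeLift {R : Type*} [Ring R] [Algebra A R] (t : Bool → R)
    (hquad : ∀ b, (t b - algebraMap A R q) * (t b + algebraMap A R qInv) = 0)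
    (hbraid : t false * t true * t false = t true * t false * t true) :
    Hecke simpleS3 →ₐ[A] R :=
  RingQuot.liftAlgHom A ⟨FreeAlgebra.lift A fun g => ((reducedWord g).map t).prod, by
    intro x y hxy
    induction hxy with
    | one =>
      have : reducedWord 1 = [] := by decide
      simp [this]
    | mul g h hgh =>
      simp only [length_simpleS3] at hgh
      simp only [map_mul, FreeAlgebra.lift_ι_apply]
      rw [← List.prod_append, ← List.map_append]
      rcases reducedWord_append g h hgh with h | ⟨h1, h2⟩
      · rw [h]
      · rw [h1, h2]
        simpa [mul_assoc] using hbraid.symm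
    | quadratic s hs =>
      obtain ⟨b, rfl⟩ := mem_simpleS3_iff.mp hs
      simpa [reducedWord_simpleRefl] using hquad b⟩

lemma heckeLift_T {R : Type*} [Ring R] [Algebra A R] (t : Bool → R) (hquad hbraid)
    (g : Equiv.Perm (Fin 3)) :
    heckeLift t hquad hbraid (T simpleS3 g) = ((reducedWord g).map t).prod := by
  simp [heckeLift, T]

lemma T_one {W : Type u} [Group W] (S : Set W) : T S 1 = 1 := by
  rw [T, RingQuot.mkAlgHom_rel A HeckeRel.one, map_one]

lemma T_mul_T {W : Type u} [Group W] {S : Set W} {g h : W}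
    (hgh : length S (g * h) = length S g + length S h) : T S g * T S h = T S (g * h) := by
  rw [T, T, ← map_mul, RingQuot.mkAlgHom_rel A (HeckeRel.mul g h hgh), T]

lemma T_quadratic {W : Type u} [Group W] {S : Set W} {s : W} (hs : s ∈ S) :
    (T S s - algebraMap A _ q) * (T S s + algebraMap A _ qInv) = 0 := by
  have := RingQuot.mkAlgHom_rel A (HeckeRel.quadratic s hs)
  simpa [T] using this

lemma mul_self_of_quadratic {R : Type*} [Ring R] [Algebra A R] {t : R}
    (h : (t - algebraMap A R q) * (t + algebraMap A R qInv) = 0) :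
    t * t = (q - qInv) • t + 1 := by
  rw [sub_mul, mul_add, mul_add, ← map_mul, q_mul_qInv, map_one, ← Algebra.smul_def,
    ← Algebra.commutes, ← Algebra.smul_def] at h
  rw [sub_smul, ← sub_eq_zero, ← h]
  abel

lemma T_mul_self {W : Type u} [Group W] {S : Set W} {s : W} (hs : s ∈ S) :
    T S s * T S s = (q - qInv) • T S s + 1 :=
  mul_self_of_quadratic (R := Hecke S) (T_quadratic hs)

lemma span_range_T : Submodule.span A (Set.range (T simpleS3)) = ⊤ := by
  set E := Submodule.span A (Set.range (T simpleS3)) with hE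
  have hT : ∀ g, T simpleS3 g ∈ E := fun g => Submodule.subset_span ⟨g, rfl⟩
  have hadd : ∀ b g, (reducedWord (simpleRefl b * g)).length = (reducedWord g).length + 1 →
      T simpleS3 (simpleRefl b) * T simpleS3 g = T simpleS3 (simpleRefl b * g) := by
    intro b g h
    apply T_mul_T
    rw [length_simpleS3, length_simpleS3, length_simpleS3, h, reducedWord_simpleRefl, add_comm]
    rfl
  have hs : ∀ b, ∀ z ∈ E, T simpleS3 (simpleRefl b) * z ∈ E := by
    intro b z hz
    induction hz using Submodule.span_induction with
    | zero => simp
    | add x y _ _ hx hy => rw [mul_add]; exact E.add_mem hx hy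
    | smul a x _ hx => rw [mul_smul_comm]; exact E.smul_mem _ hx
    | mem x hx =>
      obtain ⟨g, rfl⟩ := hx
      rcases length_reducedWord_mul b g with h | h
      · rw [hadd b g h]; exact hT _
      · have e := hadd b (simpleRefl b * g) (by rwa [simpleRefl_mul_self_mul])
        rw [simpleRefl_mul_self_mul] at e
        rw [← e, ← mul_assoc, T_mul_self (simpleRefl_mem b), add_mul, smul_mul_assoc, e, one_mul]
        exact E.add_mem (E.smul_mem _ (hT _)) (hT _)
  have hg : ∀ (n : ℕ) (g : Equiv.Perm (Fin 3)), (reducedWord g).length = n → ∀ z ∈ E,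
      T simpleS3 g * z ∈ E := by
    intro n
    induction n with
    | zero =>
      intro g hn z hz
      rcases eq_one_or_exists_descent g with rfl | ⟨b, hb⟩
      · rwa [T_one, one_mul]
      · omega
    | succ n ih =>
      intro g hn z hz
      rcases eq_one_or_exists_descent g with rfl | ⟨b, hb⟩
      · rwa [T_one, one_mul]
      · have e := hadd b (simpleRefl b * g) (by rwa [simpleRefl_mul_self_mul])
        rw [simpleRefl_mul_self_mul] at e
        rw [← e, mul_assoc]
        exact hs b _ (ih _ (by omega) z hz)
  rw [eq_top_iff]
  intro x _
  obtain ⟨x, rfl⟩ := RingQuot.mkAlgHom_surjective A (HeckeRel simpleS3) x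
  suffices ∀ z ∈ E, RingQuot.mkAlgHom A (HeckeRel simpleS3) x * z ∈ E by
    simpa using this 1 (T_one simpleS3 ▸ hT 1)
  induction x using FreeAlgebra.induction with
  | grade0 r =>
    intro z hz
    rw [AlgHom.commutes, ← Algebra.smul_def]
    exact E.smul_mem _ hz
  | grade1 g => exact hg _ g rfl
  | mul a b ha hb =>
    intro z hz
    rw [map_mul, mul_assoc]
    exact ha trivial _ (hb trivial z hz)
  | add a b ha hb =>
    intro z hz
    rw [map_add, add_mul]
    exact E.add_mem (ha trivial z hz) (hb trivial z hz)

end HeckeAlgebra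

/-! ### Monomial involutions and the independence of their words -/

/-- The combinatorial data of a family of monomial involutions: an involution `σ` of the index set,
exponents `m` that `σ` negates and signs `ε` that `σ` preserves. -/
structure ReflData (J : Type*) where
  /-- the involution of the index set -/
  σ : J → J
  /-- the exponents -/
  m : J → ℤ
  /-- the signs -/
  ε : J → ℤ
  σ_σ : ∀ a, σ (σ a) = a
  m_σ : ∀ a, m (σ a) = - m a
  ε_σ : ∀ a, ε (σ a) = ε a
  ε_sq : ∀ a, ε a * ε a = 1

namespace ReflData

variable {J : Type*} [Fintype J] [DecidableEq J] {L : Type*} [Field L]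

/-- The monomial matrix with the entries `ε a * z ^ m a` at `(a, σ a)`. -/
def refl (D : ReflData J) (z : L) : Matrix J J L :=
  Matrix.of fun a b => if b = D.σ a then (D.ε a : L) * z ^ D.m a else 0

lemma refl_mul_refl (D : ReflData J) (z w : L) :
    D.refl z * D.refl w = Matrix.diagonal fun a => (z / w) ^ D.m a := by
  ext a b
  rw [Matrix.mul_apply, Finset.sum_eq_single (D.σ a)]
  · have h2 : (D.ε a : L) * D.ε a = 1 := by exact_mod_cast congrArg (Int.cast : ℤ → L) (D.ε_sq a)
    simp only [refl, Matrix.of_apply, if_true, D.σ_σ, D.ε_σ, D.m_σ, Matrix.diagonal_apply]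
    by_cases h : a = b
    · rw [if_pos h, if_pos h.symm, zpow_neg, div_zpow, div_eq_mul_inv]
      linear_combination z ^ D.m a * (w ^ D.m a)⁻¹ * h2
    · rw [if_neg h, if_neg (Ne.symm h), mul_zero]
  · intro c _ hc
    simp [refl, hc]
  · simp

lemma refl_mul_self (D : ReflData J) {z : L} (hz : z ≠ 0) : D.refl z * D.refl z = 1 := by
  rw [D.refl_mul_refl]
  simp [div_self hz]

/-- The tensor power of the data. -/
def pi (D : ReflData J) (k : ℕ) : ReflData (Fin k → J) where
  σ a i := D.σ (a i)
  m a := ∑ i, D.m (a i)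
  ε a := ∏ i, D.ε (a i)
  σ_σ a := funext fun i => D.σ_σ (a i)
  m_σ a := by simp [D.m_σ]
  ε_σ a := by simp [D.ε_σ]
  ε_sq a := by simp [← Finset.prod_mul_distrib, D.ε_sq]

omit [Fintype J] in
lemma prod_refl (D : ReflData J) (k : ℕ) {z : L} (hz : z ≠ 0) (a b : Fin k → J) :
    ∏ i, D.refl z (a i) (b i) = (D.pi k).refl z a b := by
  have hzp : z ^ (∑ i, D.m (a i)) = ∏ i, z ^ D.m (a i) := by
    induction (Finset.univ : Finset (Fin k)) using Finset.induction_on with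
    | empty => simp
    | insert i s hi ih => rw [Finset.sum_insert hi, Finset.prod_insert hi, zpow_add₀ hz, ih]
  simp only [refl, Matrix.of_apply, Fintype.prod_ite_zero, pi, funext_iff, hzp,
    Finset.prod_mul_distrib, Int.cast_prod]

/-- The data are full up to `k`: every exponent from `1` to `k` occurs, and `σ` has fixed points of
either sign with exponent zero. -/
structure IsFull (D : ReflData J) (k : ℕ) : Prop where
  exists_m : ∀ n : ℕ, 1 ≤ n → n ≤ k → ∃ a, D.m a = n
  exists_pos : ∃ a, D.σ a = a ∧ D.m a = 0 ∧ D.ε a = 1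
  exists_neg : ∃ a, D.σ a = a ∧ D.m a = 0 ∧ D.ε a = -1

/-- With `M₁ = s • refl l` and `M₂ = s • refl 1`, the matrices `(M₁ M₂) ^ j` and `(M₁ M₂) ^ j M₁`,
for `0 ≤ j ≤ 2 k`, are linearly independent: the entries at the positions `(a, a)` and `(a, σ a)`
turn a linear relation into polynomials of degree at most `2 k` with the `2 k + 1` distinct roots
`s ^ 2 * l ^ n`, `|n| ≤ k`. -/
theorem linearIndependent_words [CharZero L] (D : ReflData J) {k : ℕ} (hD : D.IsFull k) {l s : L}
    (hl0 : l ≠ 0) (hs : s ≠ 0) (hl : ∀ n : ℕ, 1 ≤ n → l ^ n ≠ 1) {M₁ M₂ : Matrix J J L}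
    (hM₁ : M₁ = s • D.refl l) (hM₂ : M₂ = s • D.refl 1) :
    LinearIndependent L (Sum.elim (fun j : Fin (2 * k + 1) => (M₁ * M₂) ^ (j : ℕ))
      (fun j : Fin (2 * k + 1) => (M₁ * M₂) ^ (j : ℕ) * M₁)) := by
  have hx : M₁ * M₂ = Matrix.diagonal fun a => s * s * l ^ D.m a := by
    rw [hM₁, hM₂, smul_mul_smul_comm, D.refl_mul_refl, ← Matrix.diagonal_smul]
    simp [Pi.smul_def]
  rw [Fintype.linearIndependent_iff]
  intro g hg
  rw [Fintype.sum_sum_type] at hg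
  simp only [Sum.elim_inl, Sum.elim_inr, hx, Matrix.diagonal_pow] at hg
  -- the two polynomials of the relation, evaluated at `ν`
  set p : L → L := fun ν => ∑ j : Fin (2 * k + 1), ν ^ (j : ℕ) * g (Sum.inl j) with hp
  set r : L → L := fun ν => ∑ j : Fin (2 * k + 1), ν ^ (j : ℕ) * g (Sum.inr j) with hr
  have entry : ∀ a b, (if a = b then p (s * s * l ^ D.m a) else 0) +
      r (s * s * l ^ D.m a) * M₁ a b = 0 := by
    intro a b
    have h := congrFun (congrFun hg a) b
    simp only [Matrix.add_apply, Matrix.sum_apply, Matrix.smul_apply, Matrix.diagonal_mul,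
      Matrix.diagonal_apply, Pi.pow_apply, Matrix.zero_apply, smul_eq_mul] at h
    refine Eq.trans (congrArg₂ (· + ·) ?_ ?_) h
    · split_ifs
      · exact Finset.sum_congr rfl fun _ _ => mul_comm _ _
      · simp
    · rw [hr, Finset.sum_mul]
      exact Finset.sum_congr rfl fun _ _ => by ring
  have hM : ∀ a b, M₁ a b = if b = D.σ a then s * (D.ε a * l ^ D.m a) else 0 := by
    intro a b
    simp [hM₁, refl]
  have hroot : ∀ a, D.m a ≠ 0 → p (s * s * l ^ D.m a) = 0 ∧ r (s * s * l ^ D.m a) = 0 := by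
    intro a ha
    have hne : D.σ a ≠ a := fun h => ha (by have := D.m_σ a; rw [h] at this; omega)
    have hε : (D.ε a : L) ≠ 0 := by
      have h : D.ε a ≠ 0 := fun h => by simpa [h] using D.ε_sq a
      exact_mod_cast h
    constructor
    · simpa [hM, hne.symm] using entry a a
    · simpa [hM, hne, hne.symm, hε, hs, hl0, zpow_ne_zero] using entry a (D.σ a)
  -- at exponent zero, fixed points of both signs are needed to separate the two polynomials
  have hroot0 : p (s * s * l ^ (0 : ℤ)) = 0 ∧ r (s * s * l ^ (0 : ℤ)) = 0 := by
    obtain ⟨a, ha1, ha2, ha3⟩ := hD.exists_pos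
    obtain ⟨b, hb1, hb2, hb3⟩ := hD.exists_neg
    have e1 := entry a a
    have e2 := entry b b
    rw [hM, ha1] at e1
    rw [hM, hb1] at e2
    simp only [if_true, ha2, ha3, hb2, hb3] at e1 e2
    push_cast at e1 e2
    have h1 : 2 * p (s * s * l ^ (0 : ℤ)) = 0 := by linear_combination e1 + e2
    have h2 : 2 * s * r (s * s * l ^ (0 : ℤ)) = 0 := by
      rw [zpow_zero] at e1 e2 ⊢
      linear_combination e1 - e2
    exact ⟨by simpa using h1, by simpa [hs] using h2⟩
  have hall : ∀ n : ℤ, |n| ≤ k → p (s * s * l ^ n) = 0 ∧ r (s * s * l ^ n) = 0 := by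
    intro n hn
    rcases eq_or_ne n 0 with rfl | hn0
    · exact hroot0
    obtain ⟨a, ha⟩ := hD.exists_m n.natAbs (by omega) (by rw [Int.abs_eq_natAbs] at hn; omega)
    rcases Int.natAbs_eq n with h | h
    · rw [← ha] at h
      rw [h]
      exact hroot a (h ▸ hn0)
    · rw [← ha, ← D.m_σ] at h
      rw [h]
      exact hroot _ (h ▸ hn0)
  have hinj : Function.Injective fun i : Fin (2 * k + 1) => s * s * l ^ ((i : ℤ) - k) := by
    have aux : ∀ i j : ℕ, i < j → l ^ ((i : ℤ) - k) ≠ l ^ ((j : ℤ) - k) := by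
      intro i j hij h
      apply hl (j - i) (by omega)
      rw [← zpow_natCast, Nat.cast_sub hij.le,
        show (j : ℤ) - i = (j - k) - (i - k) by ring, zpow_sub₀ hl0, h,
        div_self (zpow_ne_zero _ hl0)]
    intro i j hij
    have hij := mul_left_cancel₀ (mul_ne_zero hs hs) hij
    rcases lt_trichotomy (i : ℕ) j with h | h | h
    · exact absurd hij (aux _ _ h)
    · exact Fin.ext h
    · exact absurd hij.symm (aux _ _ h)
  have hbound : ∀ i : Fin (2 * k + 1), |(i : ℤ) - k| ≤ k := fun i => by
    have := i.2
    rw [abs_le]; omega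
  have hp0 := Matrix.eq_zero_of_forall_index_sum_pow_mul_eq_zero (v := fun j => g (Sum.inl j)) hinj
    fun i => (hall _ (hbound i)).1
  have hr0 := Matrix.eq_zero_of_forall_index_sum_pow_mul_eq_zero (v := fun j => g (Sum.inr j)) hinj
    fun i => (hall _ (hbound i)).2
  rintro (j | j)
  · exact congrFun hp0 j
  · exact congrFun hr0 j

end ReflData

/-- The four weight vectors of a direct sum of the trivial, the sign and the two-dimensional
representation: `(false, _)` spans a one-dimensional representation, with the sign `- 1` for
`(false, false)`, and the `(true, _)` are eigenvectors of a Coxeter element. -/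
def weightData : ReflData (Bool × Bool) where
  σ a := if a.1 then (true, !a.2) else a
  m a := if a.1 then (if a.2 then 1 else -1) else 0
  ε a := if a.1 then 1 else (if a.2 then 1 else -1)
  σ_σ := by decide
  m_σ := by decide
  ε_σ := by decide
  ε_sq := by decide

lemma weightData_isFull : weightData.IsFull 1 where
  exists_m n h1 h2 := ⟨(true, true), by rw [le_antisymm h2 h1]; rfl⟩
  exists_pos := ⟨(false, true), rfl, rfl, rfl⟩
  exists_neg := ⟨(false, false), rfl, rfl, rfl⟩

lemma weightData_m_abs_le (a : Bool × Bool) : |weightData.m a| ≤ 1 := by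
  revert a; decide

lemma weightData_pi_isFull {k : ℕ} (hk : 1 ≤ k) : (weightData.pi k).IsFull k where
  exists_m n h1 h2 := by
    refine ⟨fun i => if (i : ℕ) < n then (true, true) else (false, true), ?_⟩
    have : ∀ i : Fin k, weightData.m (if (i : ℕ) < n then (true, true) else (false, true)) =
        if (i : ℕ) < n then 1 else 0 := fun i => by split_ifs <;> rfl
    simp only [ReflData.pi, this]
    rw [Fin.sum_univ_eq_sum_range (fun i => if i < n then (1 : ℤ) else 0) k, Finset.sum_boole,
      show (Finset.range k).filter (· < n) = Finset.range n by ext; simp; omega]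
    simp
  exists_pos := by
    refine ⟨fun _ => (false, true), rfl, ?_, ?_⟩
    · simp [ReflData.pi, weightData]
    · simp [ReflData.pi, weightData]
  exists_neg := by
    refine ⟨fun i => (false, decide (i ≠ ⟨0, hk⟩)), rfl, ?_, ?_⟩
    · simp [ReflData.pi, weightData]
    · change ∏ i : Fin k, weightData.ε (false, decide (i ≠ ⟨0, hk⟩)) = -1
      rw [Finset.prod_eq_single ⟨0, hk⟩]
      · simp [weightData]
      · intro i _ hi
        simp [weightData, hi]
      · simp

lemma weightData_pi_m_abs_le {k : ℕ} (a : Fin k → Bool × Bool) : |(weightData.pi k).m a| ≤ k := by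
  refine (Finset.abs_sum_le_sum_abs (fun i => weightData.m (a i)) Finset.univ).trans ?_
  refine (Finset.sum_le_sum fun i _ => weightData_m_abs_le (a i)).trans ?_
  simp

/-! ### The ground ring, the parameter `l` and the representation of the Hecke algebra -/

section Field

/-- The homogenized Chebyshev polynomials in `δ = u + u⁻¹`: if `m + m⁻¹ = 2 / δ`, then
`m ^ n + m ^ (-n) = 2 * δ ^ (-n) * S n`. -/
def chebS : ℕ → A
  | 0 => 1
  | 1 => 1
  | n + 2 => 2 * chebS (n + 1) - (q + qInv) ^ 2 * chebS n

/-- The roots of the polynomial satisfied by the central element. -/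
def centralRoot (k n : ℕ) : A := ((q + qInv) ^ (k - n) * chebS n) ^ 2

/-- The substitution `u = i`, which sends `u + u⁻¹` to zero. -/
def evalI : A →+* ℂ :=
  LaurentPolynomial.eval₂ (Int.castRingHom ℂ) (Units.mk0 Complex.I Complex.I_ne_zero)

lemma evalI_q_add_qInv : evalI (q + qInv) = 0 := by
  simp [evalI, q, qInv]

lemma evalI_chebS_succ (n : ℕ) : evalI (chebS (n + 1)) = 2 ^ n := by
  induction n with
  | zero => simp [chebS]
  | succ n ih =>
    rw [chebS, map_sub, map_mul, map_mul, map_pow, evalI_q_add_qInv, ih, map_ofNat]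
    ring

lemma chebS_sq_ne {n : ℕ} (hn : 1 ≤ n) : chebS n ^ 2 ≠ ((q + qInv) ^ n) ^ 2 := by
  intro h
  obtain ⟨n, rfl⟩ := Nat.exists_eq_add_of_le' hn
  have := congrArg evalI h
  rw [map_pow, evalI_chebS_succ, map_pow, map_pow, evalI_q_add_qInv, zero_pow (by omega),
    zero_pow two_ne_zero] at this
  exact pow_ne_zero 2 (pow_ne_zero n two_ne_zero) this

lemma q_add_qInv_ne_zero : q + qInv ≠ 0 := by
  intro h
  -- at `u = 1` the value is `2`
  have := congrArg (LaurentPolynomial.eval₂ (Int.castRingHom ℤ) (1 : ℤˣ)) h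
  simp [q, qInv] at this

/-- Over an algebraically closed field there is an `l`, not a root of unity, with
`l + l⁻¹ + 2 = 4 / (u + u⁻¹) ^ 2`. -/
lemma exists_parameter (L : Type*) [Field L] [IsAlgClosed L] [CharZero L] [Algebra A L]
    (hinj : Function.Injective (algebraMap A L)) :
    ∃ l : L, l ≠ 0 ∧ algebraMap A L (q + qInv) ^ 2 * (l + 1) ^ 2 = 4 * l ∧
      (∀ n : ℕ, 1 ≤ n → l ^ n ≠ 1) ∧
      ∀ k n : ℕ, n ≤ k → 4 * l ^ n * algebraMap A L (centralRoot k n) =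
        algebraMap A L ((q + qInv) ^ k) ^ 2 * (l ^ n + 1) ^ 2 := by
  set d := algebraMap A L (q + qInv) with hd
  have hd0 : d ≠ 0 := by
    rw [hd, map_ne_zero_iff _ hinj]
    exact q_add_qInv_ne_zero
  obtain ⟨w, hw⟩ := IsAlgClosed.exists_eq_mul_self ((1 / d) ^ 2 - 1)
  obtain ⟨m, m', hmm, hsum⟩ : ∃ m m' : L, m * m' = 1 ∧ d * (m + m') = 2 :=
    ⟨1 / d + w, 1 / d - w, by linear_combination hw, by field_simp; ring⟩
  have hm0 : m ≠ 0 := left_ne_zero_of_mul_eq_one hmm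
  have hS : ∀ n : ℕ, d ^ n * (m ^ n + m' ^ n) = 2 * algebraMap A L (chebS n) ∧
      d ^ (n + 1) * (m ^ (n + 1) + m' ^ (n + 1)) = 2 * algebraMap A L (chebS (n + 1)) := by
    intro n
    induction n with
    | zero =>
      refine ⟨by simp [chebS]; norm_num, by simpa [chebS] using hsum⟩
    | succ n ih =>
      refine ⟨ih.2, ?_⟩
      rw [chebS, map_sub, map_mul, map_mul, map_pow, map_ofNat, ← hd]
      linear_combination 2 * ih.2 - d ^ 2 * ih.1 +
        d ^ (n + 1) * (m ^ (n + 1) + m' ^ (n + 1)) * hsum -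
        d ^ (n + 2) * (m ^ n + m' ^ n) * hmm
  have hpow : ∀ n : ℕ, m ^ n * m' ^ n = 1 := fun n => by rw [← mul_pow, hmm, one_pow]
  refine ⟨m ^ 2, pow_ne_zero 2 hm0, ?_, ?_, ?_⟩
  · have h1 : m ^ 2 + 1 = m * (m + m') := by linear_combination -hmm
    rw [h1]
    linear_combination m ^ 2 * (d * (m + m') + 2) * hsum
  · intro n hn h
    apply chebS_sq_ne hn
    apply hinj
    have h1 : (m ^ n) ^ 2 = 1 := by rw [← pow_mul, mul_comm n, pow_mul, h]
    have h2 : m' ^ n = m ^ n := by linear_combination m ^ n * hpow n - m' ^ n * h1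
    have h3 := (hS n).1
    rw [h2] at h3
    have h4 : algebraMap A L (chebS n) = d ^ n * m ^ n := by
      have : (2 : L) * algebraMap A L (chebS n) = 2 * (d ^ n * m ^ n) := by
        linear_combination -h3
      exact mul_left_cancel₀ two_ne_zero this
    rw [map_pow, h4, map_pow, map_pow, ← hd]
    linear_combination (d ^ n) ^ 2 * h1
  · intro k n hn
    have h1 : (m ^ 2) ^ n + 1 = m ^ n * (m ^ n + m' ^ n) := by
      linear_combination - hpow n
    rw [h1, centralRoot, map_pow, map_mul, map_pow, map_pow, ← hd]
    have h2 : d ^ k = d ^ (k - n) * d ^ n := by rw [← pow_add, Nat.sub_add_cancel hn]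
    rw [h2]
    linear_combination -(m ^ n) ^ 2 * (d ^ (k - n)) ^ 2 *
      (d ^ n * (m ^ n + m' ^ n) + 2 * algebraMap A L (chebS n)) * (hS n).1

/-- An algebraically closed field that contains the ground ring. -/
abbrev BigField : Type := AlgebraicClosure (FractionRing A)

lemma algebraMap_bigField_injective : Function.Injective (algebraMap A BigField) := by
  rw [IsScalarTower.algebraMap_eq A (FractionRing A) BigField]
  exact (algebraMap (FractionRing A) BigField).injective.comp
    (IsFractionRing.injective A (FractionRing A))

instance : CharZero BigField :=
  have : CharZero A := evalI.charZero
  charZero_of_injective_algebraMap algebraMap_bigField_injective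

lemma centralRoot_zero (k : ℕ) : centralRoot k 0 = ((q + qInv) ^ k) ^ 2 := by
  simp [centralRoot, chebS]

lemma centralRoot_ne_zero_and_injOn (k : ℕ) :
    (∀ n ≤ k, centralRoot k n ≠ 0) ∧ Set.InjOn (centralRoot k) (Set.Iic k) := by
  obtain ⟨l, hl0, -, hl, hroot⟩ := exists_parameter BigField algebraMap_bigField_injective
  have hc : algebraMap A BigField ((q + qInv) ^ k) ≠ 0 := by
    rw [map_ne_zero_iff _ algebraMap_bigField_injective]
    exact pow_ne_zero _ q_add_qInv_ne_zero
  constructor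
  · intro n hn h
    have h1 := hroot k n hn
    rw [h, map_zero, mul_zero, eq_comm, mul_eq_zero, or_iff_right (pow_ne_zero 2 hc),
      pow_eq_zero_iff two_ne_zero] at h1
    rcases Nat.eq_zero_or_pos n with rfl | hn0
    · norm_num at h1
    · refine hl (n * 2) (by omega) ?_
      rw [pow_mul]
      linear_combination (l ^ n - 1) * h1
  · intro n hn p hp h
    have h1 := hroot k n hn
    have h2 := hroot k p hp
    rw [← h] at h2
    have h3 : algebraMap A BigField ((q + qInv) ^ k) ^ 2 *
        ((l ^ n - l ^ p) * (1 - l ^ (n + p))) = 0 := by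
      rw [pow_add]
      linear_combination l ^ p * h1 - l ^ n * h2
    rw [mul_eq_zero, or_iff_right (pow_ne_zero 2 hc), mul_eq_zero, sub_eq_zero, sub_eq_zero] at h3
    have aux : ∀ n p : ℕ, n < p → l ^ n ≠ l ^ p := by
      intro n p hnp h
      apply hl (p - n) (by omega)
      have : l ^ n * l ^ (p - n) = l ^ n * 1 := by
        rw [← pow_add, Nat.add_sub_cancel' hnp.le, mul_one, h]
      exact mul_left_cancel₀ (pow_ne_zero n hl0) this
    rcases h3 with h3 | h3
    · rcases lt_trichotomy n p with h | h | h
      · exact absurd h3 (aux _ _ h)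
      · exact h
      · exact absurd h3.symm (aux _ _ h)
    · by_contra hne
      exact hl (n + p) (by omega) h3.symm

end Field

section HeckeRepresentation

variable {L : Type*} [Field L] [CharZero L] [Algebra A L] {l : L} (hl0 : l ≠ 0)
  (hl : algebraMap A L (q + qInv) ^ 2 * (l + 1) ^ 2 = 4 * l)

/-- The images of the `T_s` in the direct sum of the trivial, the sign and the two-dimensional
representation, in a basis in which the product of the two normalized reflections is diagonal. -/
def weightT (l : L) (b : Bool) : Matrix (Bool × Bool) (Bool × Bool) L :=
  (2⁻¹ : L) • (algebraMap A L (q + qInv) • weightData.refl (if b then 1 else l) +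
    algebraMap A L (q - qInv) • 1)

include hl0

omit [CharZero L] [Algebra A L] in
lemma refl_ite_mul_self {J : Type*} [Fintype J] [DecidableEq J] (D : ReflData J) (b : Bool) :
    D.refl (if b then 1 else l) * D.refl (if b then 1 else l) = 1 :=
  D.refl_mul_self (by split_ifs; exacts [one_ne_zero, hl0])

lemma weightT_quadratic (b : Bool) :
    (weightT l b - algebraMap A _ q) * (weightT l b + algebraMap A _ qInv) = 0 := by
  have h := refl_ite_mul_self hl0 weightData b
  have e1 : weightT l b - algebraMap A _ q =
      (2⁻¹ * algebraMap A L (q + qInv)) • (weightData.refl (if b then 1 else l) - 1) := by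
    rw [weightT, IsScalarTower.algebraMap_apply A L (Matrix _ _ L) q,
      Algebra.algebraMap_eq_smul_one (R := L) (A := Matrix _ _ L), map_add, map_sub]
    module
  have e2 : weightT l b + algebraMap A _ qInv =
      (2⁻¹ * algebraMap A L (q + qInv)) • (weightData.refl (if b then 1 else l) + 1) := by
    rw [weightT, IsScalarTower.algebraMap_apply A L (Matrix _ _ L) qInv,
      Algebra.algebraMap_eq_smul_one (R := L) (A := Matrix _ _ L), map_add, map_sub]
    module
  have e3 : (weightData.refl (if b then 1 else l) - 1) *
      (weightData.refl (if b then 1 else l) + 1) = 0 := by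
    rw [sub_mul, mul_add, h, mul_one, one_mul]
    abel
  rw [e1, e2, smul_mul_smul_comm, e3, smul_zero]

include hl

omit [CharZero L] in
lemma refl_braid : algebraMap A L (q + qInv) ^ 2 • (weightData.refl l * weightData.refl 1 *
      weightData.refl l - weightData.refl 1 * weightData.refl l * weightData.refl 1) =
    (4 - algebraMap A L (q + qInv) ^ 2) • (weightData.refl l - weightData.refl 1) := by
  rw [ReflData.refl_mul_refl, ReflData.refl_mul_refl, div_one, one_div]
  ext a b
  simp only [Matrix.smul_apply, Matrix.sub_apply, Matrix.diagonal_mul, ReflData.refl,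
    Matrix.of_apply, smul_eq_mul]
  by_cases h : b = weightData.σ a
  · simp only [if_pos h]
    have hm := weightData_m_abs_le a
    have : weightData.m a = -1 ∨ weightData.m a = 0 ∨ weightData.m a = 1 := by
      rw [abs_le] at hm; omega
    rcases this with h | h | h <;> rw [h] <;> simp only [zpow_neg, zpow_one, zpow_zero,
      inv_one, inv_inv]
    · field_simp
      linear_combination (weightData.ε a : L) * (1 - l) * hl
    · ring
    · field_simp
      linear_combination (weightData.ε a : L) * (l - 1) * hl
  · simp [if_neg h]

lemma weightT_braid : (weightT l false : Matrix _ _ L) * weightT l true * weightT l false =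
    weightT l true * weightT l false * weightT l true := by
  have h1 := refl_ite_mul_self hl0 weightData false
  have h2 := refl_ite_mul_self hl0 weightData true
  have h3 := refl_braid hl0 hl
  have h4 : algebraMap A L (q - qInv) ^ 2 = algebraMap A L (q + qInv) ^ 2 - 4 := by
    have : (q - qInv) ^ 2 = (q + qInv) ^ 2 - 4 := by linear_combination -4 * q_mul_qInv
    rw [← map_pow, this, map_sub, map_pow, map_ofNat]
  simp only [Bool.false_eq_true, if_false, if_true] at h1 h2
  rw [← sub_eq_zero]
  simp only [weightT, Bool.false_eq_true, if_false, if_true]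
  set d := algebraMap A L (q + qInv)
  set e := algebraMap A L (q - qInv)
  set r := (weightData.refl l : Matrix _ _ L)
  set t := (weightData.refl 1 : Matrix _ _ L)
  -- the braid relation differs from `refl_braid` by a scalar, as `t * t = r * r = 1`
  have key : (2⁻¹ : L) • (d • r + e • 1) * (2⁻¹ : L) • (d • t + e • 1) *
      (2⁻¹ : L) • (d • r + e • 1) - (2⁻¹ : L) • (d • t + e • 1) *
      (2⁻¹ : L) • (d • r + e • 1) * (2⁻¹ : L) • (d • t + e • 1) =
      (8⁻¹ * d) • (d ^ 2 • (r * t * r - t * r * t) + e ^ 2 • (r - t)) := by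
    simp only [add_mul, mul_add, smul_mul_assoc, mul_smul_comm, one_mul,
      mul_one, h1, h2]
    match_scalars <;> ring
  rw [key, h3, h4]
  module

end HeckeRepresentation

/-! ### Tensor powers of the representation -/

section TensorPower

variable {R H S I : Type*} [CommRing R] [Semiring H] [Algebra R H] [CommRing S] [Algebra R S]
  [Fintype I] [DecidableEq I]

/-- The `k`-th tensor power of a matrix representation: on pure tensors, the Kronecker product. -/
def kroneckerPow (ρ : H →ₐ[R] Matrix I I S) (k : ℕ) :
    PiTensorProduct R (fun _ : Fin k => H) →ₐ[R] Matrix (Fin k → I) (Fin k → I) S :=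
  PiTensorProduct.liftAlgHom
    ((Matrix.ofLinearEquiv R).toLinearMap.compMultilinearMap <|
      MultilinearMap.pi fun a => MultilinearMap.pi fun b =>
        (MultilinearMap.mkPiAlgebra R (Fin k) S).compLinearMap fun i =>
          (Matrix.entryLinearMap R S (a i) (b i)).comp ρ.toLinearMap)
    (by
      ext a b
      simp [Matrix.one_apply, Fintype.prod_ite_zero, funext_iff])
    (by
      intro x y
      ext a b
      simp [Matrix.mul_apply, Finset.prod_univ_sum, Finset.prod_mul_distrib])

lemma kroneckerPow_tprod (ρ : H →ₐ[R] Matrix I I S) (k : ℕ) (h : Fin k → H) (a b : Fin k → I) :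
    kroneckerPow ρ k (PiTensorProduct.tprod R h) a b = ∏ i, ρ (h i) (a i) (b i) := by
  simp [kroneckerPow]

end TensorPower

/-- External products of linearly independent functions are linearly independent: dual functionals
multiply. -/
lemma linearIndependent_prod {L G X : Type*} [Field L] [Fintype G] [DecidableEq G] [Fintype X]
    [DecidableEq X] {f : G → X → L} (hf : LinearIndependent L f) (k : ℕ) :
    LinearIndependent L fun (γ : Fin k → G) (ξ : Fin k → X) => ∏ i, f (γ i) (ξ i) := by
  obtain ⟨c, hc⟩ : ∃ c : G → X → L, ∀ g g', ∑ x, c g x * f g' x = if g = g' then 1 else 0 := by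
    obtain ⟨φ, hφ⟩ := (Finsupp.linearCombination L f).exists_leftInverse_of_injective
      (LinearMap.ker_eq_bot.mpr hf)
    refine ⟨fun g x => φ (Pi.single x 1) g, fun g g' => ?_⟩
    have h1 : φ (f g') = Finsupp.single g' 1 := by
      have := LinearMap.congr_fun hφ (Finsupp.single g' 1)
      simpa using this
    have h2 : f g' = ∑ x, f g' x • Pi.single x (1 : L) := by
      conv_lhs => rw [pi_eq_sum_univ' (f g')]
    rw [h2, map_sum] at h1
    have h3 := DFunLike.congr_fun h1 g
    simp only [map_smul, Finsupp.finsetSum_apply, Finsupp.smul_apply, smul_eq_mul,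
      Finsupp.single_apply] at h3
    rw [Finset.sum_congr rfl fun x _ => mul_comm _ _, h3]
    simp [eq_comm]
  rw [Fintype.linearIndependent_iff]
  intro α hα γ
  have h : ∑ ξ : Fin k → X, (∏ i, c (γ i) (ξ i)) *
      (∑ δ : Fin k → G, α δ * ∏ i, f (δ i) (ξ i)) = 0 := by
    refine Finset.sum_eq_zero fun ξ _ => ?_
    have := congrFun hα ξ
    simp only [Finset.sum_apply, Pi.smul_apply, smul_eq_mul, Pi.zero_apply] at this
    rw [this, mul_zero]
  simp only [Finset.mul_sum] at h
  rw [Finset.sum_comm] at h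
  have h' : ∀ δ : Fin k → G, ∑ ξ : Fin k → X, (∏ i, c (γ i) (ξ i)) *
      (α δ * ∏ i, f (δ i) (ξ i)) = α δ * if γ = δ then 1 else 0 := by
    intro δ
    have : (if γ = δ then (1 : L) else 0) = ∏ i, ∑ x, c (γ i) x * f (δ i) x := by
      simp only [hc, Fintype.prod_ite_zero, funext_iff, Finset.prod_const_one]
    rw [this, Finset.prod_univ_sum, Fintype.piFinset_univ, Finset.mul_sum]
    refine Finset.sum_congr rfl fun ξ _ => ?_
    rw [Finset.prod_mul_distrib]
    ring
  simpa [h'] using h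

/-- A tensor power of a representation is faithful if a basis of the algebra has linearly
independent images over the field of the representation. -/
lemma kroneckerPow_injective {R H L I G : Type*} [CommRing R] [Semiring H] [Algebra R H] [Field L]
    [Algebra R L] (hinj : Function.Injective (algebraMap R L)) [Fintype I] [DecidableEq I]
    [Fintype G] [DecidableEq G] (b : Module.Basis G R H) (ρ : H →ₐ[R] Matrix I I L)
    (hρ : LinearIndependent L fun g => ρ (b g)) (k : ℕ) :
    Function.Injective (kroneckerPow ρ k) := by
  let β := Basis.piTensorProduct (fun _ : Fin k => b)
  -- a matrix is a function on pairs of indices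
  let e : Matrix (Fin k → I) (Fin k → I) L →ₗ[L] ((Fin k → I × I) → L) :=
    { toFun := fun M ξ => M (fun i => (ξ i).1) (fun i => (ξ i).2)
      map_add' := fun _ _ => rfl
      map_smul' := fun _ _ => rfl }
  let e₁ : Matrix I I L →ₗ[L] (I × I → L) :=
    { toFun := fun M ξ => M ξ.1 ξ.2
      map_add' := fun _ _ => rfl
      map_smul' := fun _ _ => rfl }
  have he₁ : LinearMap.ker e₁ = ⊥ := by
    rw [LinearMap.ker_eq_bot]
    intro M M' h
    ext i j
    exact congrFun h (i, j)
  have h1 := linearIndependent_prod (hρ.map' e₁ he₁) k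
  have h2 : LinearIndependent L fun γ => kroneckerPow ρ k (β γ) := by
    refine LinearIndependent.of_comp e ?_
    convert h1 using 1
    ext γ ξ
    simp only [Function.comp_apply, β, Basis.piTensorProduct_apply]
    exact kroneckerPow_tprod ρ k _ _ _
  have h3 : LinearIndependent R fun γ => kroneckerPow ρ k (β γ) :=
    h2.restrict_scalars (by simpa [Algebra.smul_def] using hinj)
  intro x y hxy
  have h4 : ∀ x, kroneckerPow ρ k x =
      Finsupp.linearCombination R (fun γ => kroneckerPow ρ k (β γ)) (β.repr x) := by
    intro x
    conv_lhs => rw [← β.linearCombination_repr x]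
    rw [Finsupp.linearCombination_apply, Finsupp.linearCombination_apply, map_finsuppSum]
    simp only [map_smul]
  rw [h4, h4] at hxy
  exact β.repr.injective (h3 hxy)

lemma map_add_add_sub {R R' : Type*} [Ring R] [Ring R'] [Algebra A R] [Algebra A R']
    (f : R →ₐ[A] R') (t : R) (a b : A) :
    f ((t + algebraMap A R a) + (t - algebraMap A R b)) =
      f t + f t + algebraMap A R' (a - b) := by
  simp only [map_add, map_sub, AlgHom.commutes]
  abel

section Faithful

variable {L : Type*} [Field L] [CharZero L] [Algebra A L] {l : L} (hl0 : l ≠ 0)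
  (hl : algebraMap A L (q + qInv) ^ 2 * (l + 1) ^ 2 = 4 * l)

/-- The direct sum of the trivial, the sign and the two-dimensional representation. -/
def weightHom : Hecke simpleS3 →ₐ[A] Matrix (Bool × Bool) (Bool × Bool) L :=
  heckeLift (weightT l) (weightT_quadratic hl0) (weightT_braid hl0 hl)

lemma weightHom_CPrime_add_C (b : Bool) :
    weightHom hl0 hl (CPrime simpleS3 (simpleRefl b) + C simpleS3 (simpleRefl b)) =
      algebraMap A L (q + qInv) • weightData.refl (if b then 1 else l) := by
  have h : weightHom hl0 hl (T simpleS3 (simpleRefl b)) = weightT l b := by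
    rw [weightHom, heckeLift_T, reducedWord_simpleRefl]
    simp
  have h2 : weightHom hl0 hl (CPrime simpleS3 (simpleRefl b) + C simpleS3 (simpleRefl b)) = _ :=
    map_add_add_sub (R := Hecke simpleS3) (weightHom hl0 hl) (T simpleS3 (simpleRefl b)) qInv q
  rw [h2, h, IsScalarTower.algebraMap_apply A L (Matrix _ _ L),
    Algebra.algebraMap_eq_smul_one (R := L) (A := Matrix _ _ L), weightT, map_sub, map_sub, map_add]
  module

variable (hinj : Function.Injective (algebraMap A L)) (hroot : ∀ n : ℕ, 1 ≤ n → l ^ n ≠ 1)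

include hinj hroot

lemma linearIndependent_weightHom_T :
    LinearIndependent L fun g => weightHom hl0 hl (T simpleS3 g) := by
  set ρ := weightHom hl0 hl with hρ
  set W := Submodule.span L (Set.range fun g => ρ (T simpleS3 g)) with hW
  have hmem : ∀ h, ρ h ∈ W := by
    intro h
    have hh : h ∈ Submodule.span A (Set.range (T simpleS3)) := span_range_T ▸ Submodule.mem_top
    induction hh using Submodule.span_induction with
    | mem x hx =>
      obtain ⟨g, rfl⟩ := hx
      exact Submodule.subset_span ⟨g, rfl⟩
    | zero => rw [map_zero]; exact W.zero_mem
    | add x y _ _ hx hy => rw [map_add]; exact W.add_mem hx hy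
    | smul a x _ hx => rw [map_smul, ← algebraMap_smul L]; exact W.smul_mem _ hx
  have hd : algebraMap A L (q + qInv) ≠ 0 := by
    rw [map_ne_zero_iff _ hinj]
    exact q_add_qInv_ne_zero
  set D : Bool → Hecke simpleS3 := fun b =>
    CPrime simpleS3 (simpleRefl b) + C simpleS3 (simpleRefl b)
  have h₁ : ρ (D false) = algebraMap A L (q + qInv) • weightData.refl l := by
    rw [hρ, weightHom_CPrime_add_C]; rfl
  have h₂ : ρ (D true) = algebraMap A L (q + qInv) • weightData.refl 1 := by
    rw [hρ, weightHom_CPrime_add_C]; rfl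
  have hli := ReflData.linearIndependent_words weightData weightData_isFull hl0 hd hroot h₁ h₂
  have hw : ∀ i, (Sum.elim (fun j : Fin (2 * 1 + 1) => (ρ (D false) * ρ (D true)) ^ (j : ℕ))
      (fun j : Fin (2 * 1 + 1) => (ρ (D false) * ρ (D true)) ^ (j : ℕ) * ρ (D false))) i ∈ W := by
    rintro (j | j)
    · simp only [Sum.elim_inl]
      rw [← map_mul, ← map_pow]
      exact hmem _
    · simp only [Sum.elim_inr]
      rw [← map_mul, ← map_pow, ← map_mul]
      exact hmem _
  rw [linearIndependent_iff_card_eq_finrank_span]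
  refine le_antisymm ?_ (finrank_range_le_card _)
  have hcard : Fintype.card (Equiv.Perm (Fin 3)) = 6 := by decide
  rw [hcard]
  -- six independent words in the images of `T_s` lie in the span
  have hli' : LinearIndependent L (fun i => (⟨_, hw i⟩ : W)) :=
    LinearIndependent.of_comp W.subtype hli
  have hle : 6 ≤ Module.finrank L W := by simpa using hli'.fintype_card_le_finrank
  exact hle

/-- The standard basis of the Hecke algebra. -/
def heckeBasis : Module.Basis (Equiv.Perm (Fin 3)) A (Hecke simpleS3) :=
  Module.Basis.mk (v := T simpleS3)
    (LinearIndependent.of_comp (weightHom hl0 hl).toLinearMap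
      ((linearIndependent_weightHom_T hl0 hl hinj hroot).restrict_scalars
        (by simpa [Algebra.smul_def] using hinj)))
    span_range_T.ge

lemma kroneckerPow_weightHom_injective (k : ℕ) :
    Function.Injective (kroneckerPow (weightHom hl0 hl) k) := by
  refine kroneckerPow_injective hinj (heckeBasis hl0 hl hinj hroot) _ ?_ k
  simpa [heckeBasis] using linearIndependent_weightHom_T hl0 hl hinj hroot

end Faithful

/-- A sum over the sign vectors with an even number of minus signs, by the expansion of the tensor
powers of `f true + f false` and of `f true - f false`. -/
lemma two_smul_sum_even {R H : Type*} [CommRing R] [Ring H] [Algebra R H] (k : ℕ) (f : Bool → H)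
    {d : R} (hd : f true + f false = d • 1) :
    (2 : R) • (∑ a : Fin k → Bool with Even (Finset.univ.filter fun i => a i = false).card,
      PiTensorProduct.tprod R fun i => f (a i)) =
      d ^ k • (1 : PiTensorProduct R fun _ : Fin k => H) +
        PiTensorProduct.tprod R fun _ => f true - f false := by
  have e1 : d ^ k • (1 : PiTensorProduct R fun _ : Fin k => H) =
      ∑ a : Fin k → Bool, PiTensorProduct.tprod R fun i => f (a i) := by
    have h := MultilinearMap.map_sum (PiTensorProduct.tprod R (s := fun _ : Fin k => H))
      (fun _ b => f b)
    simp only [Fintype.sum_bool, hd] at h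
    rw [← h]
    have := MultilinearMap.map_smul_univ (PiTensorProduct.tprod R (s := fun _ : Fin k => H))
      (fun _ => d) 1
    simp only [Pi.one_apply, Finset.prod_const, Finset.card_univ, Fintype.card_fin] at this
    rw [this, PiTensorProduct.one_def]
  have e2 : (PiTensorProduct.tprod R fun _ : Fin k => f true - f false) =
      ∑ a : Fin k → Bool, (-1 : R) ^ (Finset.univ.filter fun i => a i = false).card •
        PiTensorProduct.tprod R fun i => f (a i) := by
    have h : f true - f false = ∑ b, (if b = false then (-1 : R) else 1) • f b := by
      simp [sub_eq_add_neg]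
    rw [h, MultilinearMap.map_sum]
    refine Finset.sum_congr rfl fun a _ => ?_
    rw [MultilinearMap.map_smul_univ, Finset.prod_ite, Finset.prod_const, Finset.prod_const_one,
      mul_one]
  rw [e1, e2, ← Finset.sum_add_distrib, Finset.sum_filter, Finset.smul_sum]
  refine Finset.sum_congr rfl fun a _ => ?_
  split_ifs with h
  · rw [h.neg_one_pow, one_smul, two_smul]
  · rw [(Nat.not_even_iff_odd.mp h).neg_one_pow, smul_zero, neg_smul, one_smul, add_neg_cancel]

lemma add_add_neg_sub {R : Type*} [Ring R] [Algebra A R] (t : R) (a b : A) :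
    (t + algebraMap A R a) + -(t - algebraMap A R b) = (b + a) • 1 := by
  rw [← Algebra.algebraMap_eq_smul_one, map_add]
  abel

/-- Twice the generator, as `[2] ^ k` times the sum of the identity and of the tensor power of the
involution `(C'_s + C_s) / [2]`. -/
lemma two_smul_P {W : Type u} [Group W] (S : Set W) (k : ℕ) (s : W) :
    (2 : A) • P S k s = (q + qInv) ^ k • (1 : HeckePow S k) +
      PiTensorProduct.tprod A fun _ => CPrime S s + C S s := by
  have h1 := two_smul_sum_even (H := Hecke S) k (scaledIdem S s)
    (add_add_neg_sub (R := Hecke S) (T S s) qInv q)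
  have h2 : CPrime S s - -C S s = CPrime S s + C S s :=
    sub_neg_eq_add (α := Hecke S) _ _
  rw [← h2]
  exact h1

/-! ### The nonstandard Hecke algebra -/

/-- The polynomial with the roots `centralRoot k n`, `1 ≤ n ≤ k`. -/
def centralPoly (k : ℕ) : A[X] := ∏ n ∈ Finset.Icc 1 k, (X - Polynomial.C (centralRoot k n))

lemma centralPoly_monic (k : ℕ) : (centralPoly k).Monic :=
  monic_prod_X_sub_C _ _

lemma centralPoly_natDegree (k : ℕ) : (centralPoly k).natDegree = k := by
  rw [centralPoly, natDegree_finsetProd_X_sub_C_eq_card]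
  simp

lemma map_centralElt {R B B' : Type*} [CommRing R] [Ring B] [Algebra R B] [Ring B'] [Algebra R B']
    (φ : B →ₐ[R] B') (c : R) (P₁ P₂ : B) :
    φ (centralElt c P₁ P₂) = centralElt c (φ P₁) (φ P₂) := by
  simp [centralElt]

section MatrixIdentities

variable {L : Type*} [Field L] [CharZero L] [Algebra A L] {l : L} (hl0 : l ≠ 0) {k : ℕ}

/-- The image of the generator in the tensor power of the sum of the irreducible representations. -/
def matP (k : ℕ) (l : L) (b : Bool) : Matrix (Fin k → Bool × Bool) (Fin k → Bool × Bool) L :=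
  (2⁻¹ * algebraMap A L ((q + qInv) ^ k)) •
    (1 + (weightData.pi k).refl (if b then 1 else l))

include hl0

lemma matP_mul_self (b : Bool) : matP k l b * matP k l b = (q + qInv) ^ k • matP k l b := by
  have h := refl_ite_mul_self hl0 (weightData.pi k) b
  rw [← algebraMap_smul L ((q + qInv) ^ k), matP, smul_mul_smul_comm, mul_add, add_mul, add_mul, h]
  simp only [one_mul, mul_one]
  match_scalars <;> field_simp <;> ring

/-- The central element acts diagonally, by `[2] ^ (2 k) (l ^ m + 2 + l ^ (- m)) / 4`. -/
lemma centralElt_matP : centralElt ((q + qInv) ^ k) (matP k l false) (matP k l true) =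
    Matrix.diagonal fun a => 4⁻¹ * algebraMap A L ((q + qInv) ^ k) ^ 2 *
      (2 + l ^ (weightData.pi k).m a + l⁻¹ ^ (weightData.pi k).m a) := by
  have h1 := refl_ite_mul_self hl0 (weightData.pi k) false
  have h2 := refl_ite_mul_self hl0 (weightData.pi k) true
  simp only [Bool.false_eq_true, if_false, if_true] at h1 h2
  have h3 : matP k l false - matP k l true = (2⁻¹ * algebraMap A L ((q + qInv) ^ k)) •
      ((weightData.pi k).refl l - (weightData.pi k).refl 1) := by
    simp only [matP, Bool.false_eq_true, if_false, if_true]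
    module
  rw [centralElt, h3, pow_two (_ • _), smul_mul_smul_comm, mul_sub, sub_mul, sub_mul, h1, h2,
    ReflData.refl_mul_refl, ReflData.refl_mul_refl,
    IsScalarTower.algebraMap_apply A L (Matrix _ _ L),
    Algebra.algebraMap_eq_smul_one (R := L) (A := Matrix _ _ L), map_pow, div_one, one_div]
  ext a b
  by_cases h : a = b
  · subst h
    simp only [Matrix.sub_apply, Matrix.smul_apply, Matrix.one_apply_eq, Matrix.diagonal_apply_eq,
      smul_eq_mul]
    ring
  · simp [Matrix.one_apply_ne h, Matrix.diagonal_apply_ne _ h]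

/-- The defining relation: in the rows with `m a ≠ 0` the diagonal matrix `centralPoly` vanishes,
and in the rows with `m a = 0` the two generators agree. -/
lemma aeval_centralPoly_matP
    (hroot : ∀ n : ℕ, n ≤ k → 4 * l ^ n * algebraMap A L (centralRoot k n) =
        algebraMap A L ((q + qInv) ^ k) ^ 2 * (l ^ n + 1) ^ 2) :
    aeval (centralElt ((q + qInv) ^ k) (matP k l false) (matP k l true)) (centralPoly k) *
      (matP k l false - matP k l true) = 0 := by
  rw [centralElt_matP hl0]
  set v : (Fin k → Bool × Bool) → L := fun a => 4⁻¹ * algebraMap A L ((q + qInv) ^ k) ^ 2 *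
      (2 + l ^ (weightData.pi k).m a + l⁻¹ ^ (weightData.pi k).m a) with hv
  have h1 : aeval (Matrix.diagonal v) (centralPoly k) =
      Matrix.diagonal fun a => aeval (v a) (centralPoly k) := by
    have h2 := aeval_algHom_apply (Matrix.diagonalAlgHom A) v (centralPoly k)
    rw [Matrix.diagonalAlgHom_apply] at h2
    rw [h2, Matrix.diagonalAlgHom_apply]
    congr 1
    ext a
    exact (aeval_algHom_apply (Pi.evalAlgHom A (fun _ => L) a) v (centralPoly k)).symm
  rw [h1]
  ext a b
  rw [Matrix.diagonal_mul, Matrix.zero_apply]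
  by_cases hm : (weightData.pi k).m a = 0
  · have : (matP k l false - matP k l true) a b = 0 := by
      simp [matP, ReflData.refl, hm]
    rw [this, mul_zero]
  · have hle := weightData_pi_m_abs_le a
    rw [Int.abs_eq_natAbs] at hle
    set n := ((weightData.pi k).m a).natAbs with hn
    have hln : l ^ n ≠ 0 := pow_ne_zero n hl0
    have hva : v a = algebraMap A L (centralRoot k n) := by
      have h3 : l ^ (weightData.pi k).m a + l⁻¹ ^ (weightData.pi k).m a = l ^ n + (l ^ n)⁻¹ := by
        rcases Int.natAbs_eq ((weightData.pi k).m a) with h | h <;> rw [h, ← hn]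
        · simp
        · simp [add_comm]
      have h4 := hroot n (by omega)
      have h5 : v a = 4⁻¹ * algebraMap A L ((q + qInv) ^ k) ^ 2 * (2 + (l ^ n + (l ^ n)⁻¹)) := by
        rw [← h3, hv]; ring
      rw [h5]
      field_simp
      linear_combination -h4
    have h6 : aeval (v a) (centralPoly k) = 0 := by
      rw [centralPoly, map_prod]
      refine Finset.prod_eq_zero (i := n) (Finset.mem_Icc.mpr ⟨by omega, by omega⟩) ?_
      rw [map_sub, aeval_X, aeval_C, hva, sub_self]
    rw [h6, zero_mul]

end MatrixIdentities

section Conclusion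

variable {L : Type*} [Field L] [CharZero L] [Algebra A L] {l : L} (hl0 : l ≠ 0) {k : ℕ}
  {N : Type*} [Ring N] [Algebra A N] {P₁ P₂ : N}
  (hadj : Algebra.adjoin A {P₁, P₂} = ⊤)
  (Ψ : N →ₐ[A] Matrix (Fin k → Bool × Bool) (Fin k → Bool × Bool) L)
  (hP₁ : Ψ P₁ = matP k l false) (hP₂ : Ψ P₂ = matP k l true)
  (hinj : Function.Injective (algebraMap A L)) (hl : ∀ n : ℕ, 1 ≤ n → l ^ n ≠ 1)

include hl0 hP₁ hP₂ hinj hl in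
lemma exists_linearIndependent (hk : 1 ≤ k) :
    ∃ v : Fin (2 * k + 1) ⊕ Fin (2 * k + 1) → N, LinearIndependent A v := by
  have hc : algebraMap A L ((q + qInv) ^ k) ≠ 0 := by
    rw [map_ne_zero_iff _ hinj]
    exact pow_ne_zero _ q_add_qInv_ne_zero
  have e : ∀ b, (2 : A) • matP k l b - algebraMap A _ ((q + qInv) ^ k) =
      algebraMap A L ((q + qInv) ^ k) • (weightData.pi k).refl (if b then 1 else l) := by
    intro b
    rw [← algebraMap_smul L (2 : A), matP, IsScalarTower.algebraMap_apply A L (Matrix _ _ L),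
      Algebra.algebraMap_eq_smul_one (R := L) (A := Matrix _ _ L), map_ofNat]
    match_scalars <;> field_simp
    ring
  have e1 : Ψ ((2 : A) • P₁ - algebraMap A _ ((q + qInv) ^ k)) =
      algebraMap A L ((q + qInv) ^ k) • (weightData.pi k).refl l := by
    rw [map_sub, map_smul, AlgHom.commutes, hP₁, e]
    rfl
  have e2 : Ψ ((2 : A) • P₂ - algebraMap A _ ((q + qInv) ^ k)) =
      algebraMap A L ((q + qInv) ^ k) • (weightData.pi k).refl 1 := by
    rw [map_sub, map_smul, AlgHom.commutes, hP₂, e]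
    rfl
  have hli := ReflData.linearIndependent_words (weightData.pi k) (weightData_pi_isFull hk) hl0 hc hl
    e1 e2
  set u₁ := (2 : A) • P₁ - algebraMap A N ((q + qInv) ^ k)
  set u₂ := (2 : A) • P₂ - algebraMap A N ((q + qInv) ^ k)
  refine ⟨Sum.elim (fun j => (u₁ * u₂) ^ (j : ℕ)) (fun j => (u₁ * u₂) ^ (j : ℕ) * u₁),
    LinearIndependent.of_comp Ψ.toLinearMap ?_⟩
  have hli' := hli.restrict_scalars (R := A) (by simpa [Algebra.smul_def] using hinj)
  have hv : Ψ.toLinearMap ∘ Sum.elim (fun j : Fin (2 * k + 1) => (u₁ * u₂) ^ (j : ℕ))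
      (fun j : Fin (2 * k + 1) => (u₁ * u₂) ^ (j : ℕ) * u₁) =
      Sum.elim (fun j : Fin (2 * k + 1) => (Ψ u₁ * Ψ u₂) ^ (j : ℕ))
        (fun j : Fin (2 * k + 1) => (Ψ u₁ * Ψ u₂) ^ (j : ℕ) * Ψ u₁) := by
    ext i : 1
    rcases i with j | j <;> simp
  rw [hv]
  exact hli'

variable (hΨ : Function.Injective Ψ)
  (hroot : ∀ n : ℕ, n ≤ k → 4 * l ^ n * algebraMap A L (centralRoot k n) =
    algebraMap A L ((q + qInv) ^ k) ^ 2 * (l ^ n + 1) ^ 2)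

include hl0 hP₁ hP₂ hΨ

lemma relations_of_faithful : P₁ * P₁ = (q + qInv) ^ k • P₁ ∧ P₂ * P₂ = (q + qInv) ^ k • P₂ := by
  constructor <;> apply hΨ
  · rw [map_mul, map_smul, hP₁, matP_mul_self hl0]
  · rw [map_mul, map_smul, hP₂, matP_mul_self hl0]

include hroot

lemma relation_of_faithful :
    aeval (centralElt ((q + qInv) ^ k) P₁ P₂) (centralPoly k) * (P₁ - P₂) = 0 := by
  apply hΨ
  rw [map_mul, map_sub, ← aeval_algHom_apply, map_centralElt, hP₁, hP₂,
    aeval_centralPoly_matP hl0 hroot, map_zero]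

include hinj hl hadj

lemma free_and_finrank_of_faithful
    (hk : 1 ≤ k) :
    Module.Free A N ∧ Module.finrank A N = 4 * k + 2 := by
  obtain ⟨h₁, h₂⟩ := relations_of_faithful hl0 Ψ hP₁ hP₂ hΨ
  have hspan := span_spanningFamily_eq_top h₁ h₂ (centralPoly_monic k)
    (relation_of_faithful hl0 Ψ hP₁ hP₂ hΨ hroot) hadj
  obtain ⟨v, hv⟩ := exists_linearIndependent hl0 Ψ hP₁ hP₂ hinj hl hk
  have := free_and_finrank_of_span_of_linearIndependent hspan hv (by
    rw [centralPoly_natDegree]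
    simp only [Fintype.card_sum, Fintype.card_fin]
    ring)
  refine ⟨this.1, this.2.trans ?_⟩
  simp only [Fintype.card_sum, Fintype.card_fin]
  ring

end Conclusion

/-- Over a field of fractions `K` the roots of `centralPoly` are distinct, nonzero and different
from `[2] ^ (2 k)`, so that the criterion for split semisimplicity applies to `K ⊗ N`. -/
lemma isSplitSemisimple_baseChange (K : Type u) [Field K] [Algebra A K] [IsFractionRing A K]
    {N : Type v} [Ring N] [Algebra A N] {P₁ P₂ : N} (hadj : Algebra.adjoin A {P₁, P₂} = ⊤) {k : ℕ}
    (h₁ : P₁ * P₁ = (q + qInv) ^ k • P₁) (h₂ : P₂ * P₂ = (q + qInv) ^ k • P₂)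
    (hrel : aeval (centralElt ((q + qInv) ^ k) P₁ P₂) (centralPoly k) * (P₁ - P₂) = 0) :
    IsSplitSemisimple.{u, max u v, w, x} K (K ⊗[A] N) := by
  classical
  have hK : Function.Injective (algebraMap A K) := IsFractionRing.injective A K
  obtain ⟨hne, hinj⟩ := centralRoot_ne_zero_and_injOn k
  set ι : N →ₐ[A] K ⊗[A] N := Algebra.TensorProduct.includeRight with hι
  set c := (q + qInv) ^ k with hc
  have hsmul : ∀ P : N, P * P = c • P → ι P * ι P = algebraMap A K c • ι P := by
    intro P hP
    rw [← map_mul, hP, map_smul, algebraMap_smul]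
  refine isSplitSemisimple_of_scaledIdempotents (c := algebraMap A K c) (P₁ := ι P₁) (P₂ := ι P₂)
    (s := (Finset.Icc 1 k).image fun n => algebraMap A K (centralRoot k n)) ?_ ?_ (hsmul _ h₁)
    (hsmul _ h₂) ?_ ?_ ?_
  · rw [← Algebra.TensorProduct.adjoin_one_tmul_image_eq_top (A := K) _ hadj, Set.image_pair]
    rfl
  · rw [map_ne_zero_iff _ hK]
    exact pow_ne_zero _ q_add_qInv_ne_zero
  · simp only [Finset.mem_image, Finset.mem_Icc, not_exists, not_and]
    intro n hn h
    exact hne n hn.2 ((map_eq_zero_iff _ hK).mp h)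
  · simp only [Finset.mem_image, Finset.mem_Icc, not_exists, not_and]
    intro n hn h
    rw [← map_pow, hc, ← centralRoot_zero] at h
    have := hinj hn.2 (Nat.zero_le k) (hK h)
    omega
  · have h3 : ∏ z ∈ (Finset.Icc 1 k).image (fun n => algebraMap A K (centralRoot k n)),
        (X - Polynomial.C z) = (centralPoly k).map (algebraMap A K) := by
      rw [Finset.prod_image, centralPoly, Polynomial.map_prod]
      · simp
      · intro a ha b hb h
        simp only [Finset.coe_Icc, Set.mem_Icc] at ha hb
        exact hinj ha.2 hb.2 (hK h)
    have h4 : centralElt (algebraMap A K c) (ι P₁) (ι P₂) = ι (centralElt c P₁ P₂) := by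
      rw [map_centralElt, centralElt, centralElt, ← map_pow, ← IsScalarTower.algebraMap_apply]
    rw [h3, h4, aeval_map_algebraMap, aeval_algHom_apply, ← map_sub, ← map_mul, hrel, map_zero]

end NSHecke

end

open NSHecke in
theorem corollaryc (k : ℕ) (hk : 1 ≤ k) :
    (∀ (K : Type u) [Field K] [Algebra NSHecke.A K] [IsFractionRing NSHecke.A K],
      NSHecke.IsSplitSemisimple.{u, u, w, x} K
        (K ⊗[NSHecke.A] NSHecke.Nonstandard NSHecke.simpleS3 k)) ∧
    Module.Free NSHecke.A (NSHecke.Nonstandard NSHecke.simpleS3 k) ∧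
    Module.finrank NSHecke.A (NSHecke.Nonstandard NSHecke.simpleS3 k) = 4 * k + 2 := by
  obtain ⟨l, hl0, hl, hroot, hcentral⟩ := exists_parameter BigField algebraMap_bigField_injective
  set Φ := kroneckerPow (weightHom hl0 hl) k with hΦ
  have hmem : ∀ b, P simpleS3 k (simpleRefl b) ∈ Nonstandard simpleS3 k := fun b =>
    Algebra.subset_adjoin ⟨_, simpleRefl_mem b, rfl⟩
  have hval : ∀ b, Φ (P simpleS3 k (simpleRefl b)) = matP k l b := by
    intro b
    have h := congrArg Φ (two_smul_P simpleS3 k (simpleRefl b))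
    rw [map_smul, map_add, map_smul, map_one] at h
    have h2 : Φ (PiTensorProduct.tprod A fun _ =>
        CPrime simpleS3 (simpleRefl b) + NSHecke.C simpleS3 (simpleRefl b)) =
        algebraMap A BigField ((q + qInv) ^ k) •
          (weightData.pi k).refl (if b then 1 else l) := by
      ext a a'
      rw [hΦ, kroneckerPow_tprod]
      simp only [weightHom_CPrime_add_C, Matrix.smul_apply, smul_eq_mul, Finset.prod_mul_distrib,
        Finset.prod_const, Finset.card_univ, Fintype.card_fin]
      rw [ReflData.prod_refl _ _ (by split_ifs; exacts [one_ne_zero, hl0]), map_pow]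
    rw [h2, ← algebraMap_smul BigField (2 : A), ← algebraMap_smul BigField ((q + qInv) ^ k),
      ← smul_add, map_ofNat] at h
    rw [matP, mul_smul, ← h, smul_smul, inv_mul_cancel₀ two_ne_zero, one_smul]
  set p : Bool → Nonstandard simpleS3 k := fun b => ⟨_, hmem b⟩
  have hadj : Algebra.adjoin A {p false, p true} = ⊤ := by
    rw [← Algebra.adjoin_adjoin_coe_preimage (R := A) (s := P simpleS3 k '' simpleS3)]
    congr 1
    ext z
    simp only [Set.mem_insert_iff, Set.mem_singleton_iff, Set.mem_preimage, Set.mem_image,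
      mem_simpleS3_iff, Subtype.ext_iff, p]
    constructor
    · rintro (h | h)
      exacts [⟨_, ⟨false, rfl⟩, h.symm⟩, ⟨_, ⟨true, rfl⟩, h.symm⟩]
    · rintro ⟨_, ⟨b, rfl⟩, h⟩
      cases b
      exacts [Or.inl h.symm, Or.inr h.symm]
  -- negation on `Nonstandard simpleS3 k`, on top of its given semiring structure
  let : Ring (Nonstandard simpleS3 k) := Algebra.semiringToRing A
  set Ψ := Φ.comp (Nonstandard simpleS3 k).val
  have hΨ : Function.Injective Ψ :=
    (kroneckerPow_weightHom_injective hl0 hl algebraMap_bigField_injective hroot k).comp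
      Subtype.val_injective
  have hP₁ : Ψ (p false) = matP k l false := hval false
  have hP₂ : Ψ (p true) = matP k l true := hval true
  have hfree := free_and_finrank_of_faithful (N := Nonstandard simpleS3 k) hl0 hadj Ψ hP₁ hP₂
    algebraMap_bigField_injective hroot hΨ (hcentral k) hk
  refine ⟨fun K _ _ _ => ?_, hfree⟩
  obtain ⟨h₁, h₂⟩ := relations_of_faithful (N := Nonstandard simpleS3 k) hl0 Ψ hP₁ hP₂ hΨ
  exact isSplitSemisimple_baseChange K (N := Nonstandard simpleS3 k) hadj h₁ h₂
    (relation_of_faithful (N := Nonstandard simpleS3 k) hl0 Ψ hP₁ hP₂ hΨ (hcentral k))
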